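/- Conventions. All Banach spaces are real, complete, and of dimension at least $2$; a domain is a non-empty open connected set. For a domain $D\subsetneq E$ let $d_D(z)$ be the distance from $z\in D$ to $\partial D$, let $$j_D(x,y)=\log\Bigl(1+\frac{|x-y|}{\min\{d_D(x),d_D(y)\}}\Bigr),\qquad k_D(x,y)=\inf_\alpha\int_\alpha\frac{|dz|}{d_D(z)},$$ the infimum being over all rectifiable paths $\alpha$ from $x$ to $y$ in $D$. A growth function is a homeomorphism $\varphi:[0,\infty)\to[0,\infty)$ with $\varphi(t)\ge t$ for all $t$. For domains $D\subsetneq E$, $D'\subsetneq E'$, a homeomorphism $f:D\to D'$ is $M$-quasihyperbolic ($M$-QH) if $k_D(x,y)/M\le k_{D'}(f(x),f(y))\le M k_D(x,y)$ for all $x,y\in D$; it is $\varphi$-FQC (freely $\varphi$-quasiconformal), for a growth function $\varphi$, if for every domain $D_1\subset D$ and $D_1'=f(D_1)$ we have $k_{D_1'}(f(x),f(y))\le\varphi(k_{D_1}(x,y))$ and $k_{D_1}(x,y)\le\varphi(k_{D_1'}(f(x),f(y)))$ for all $x,y\in D_1$. For a self-homeomorphism $\varphi$ of $[0,\infty)$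 and a domain $D_1\subset D$ with $D_1'=f(D_1)$, consider the $j$-metric inequality $$\varphi^{-1}(j_{D_1}(x,y))\le j_{D_1'}(f(x),f(y))\le\varphi(j_{D_1}(x,y))\quad\text{for all }x,y\in D_1.\tag{$*$}$$ Theorem 1.3. Theorem 1.2 asserts that if there is a growth function $\varphi$ for which $(*)$ holds on every subdomain $D_1\subset D$, then $f$ is FQC, and that if $(*)$ holds for $D_1=D$ with $\varphi(t)=Mt$, $M\ge1$, then $f$ is $M_1$-QH for some $M_1$. Both converses fail: (a) It is not true that for all domains $D\subsetneq E$, $D'\subsetneq E'$ in Banach spaces and every homeomorphism $f:D\to D'$ that is $\varphi_1$-FQC for some growth function $\varphi_1$, there is a growth function $\varphi$ such that $(*)$ holds for every domain $D_1\subset D$. (b) It is not true that for all such $D,D'$ and every homeomorphism $f:D\to D'$ that is $M_1$-QH for some $M_1>1$, there is $M\ge1$ such that $(*)$ holds with $D_1=D$ and $\varphi(t)=Mt$. More precisely, the following are examples. (c) There is a conformal map of the unit disk $D=\mathbb B(0,1)\subset\mathbb C$ onto the slit disk $D'=\mathbb B(0,1)\setminus[0,1)$. There is a constant $M>1$ such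 that every such map $f$ is $M$-QH and $\varphi_1$-FQC with $\varphi_1(t)=Mt$. For every such $f$ and every self-homeomorphism $\varphi$ of $[0,\infty)$, $(*)$ fails for $D_1=D$ and also for $D_1=D\setminus\{f^{-1}(-\tfrac12)\}$. (d) Let $H$ be a real Hilbert space with an orthonormal basis $(e_j)_{j\in\mathbb Z}$, let $0<r\le\frac1{10}$, let $\gamma$ be the line spanned by $e_1$, $D=\gamma+\mathbb B(0,r)$, and let $\gamma'=\bigcup_{j\in\mathbb Z}[e_{j-1},e_j]$ be the infinite broken line. Call a homeomorphism locally $M$-bilipschitz ($M\ge 1$) if every point has a neighborhood in which $|y-z|/M\le|f(y)-f(z)|\le M|y-z|$ for all $y,z$. For some $M\ge1$ there is a locally $M$-bilipschitz homeomorphism $f$ of $D$ onto an open neighborhood $D'\subset\mathbb B(0,2)$ of $\gamma'$, with $f(\gamma)=\gamma'$. Moreover, for every $M\ge1$, every locally $M$-bilipschitz homeomorphism $f$ of $D$ onto a bounded open neighborhood $D'$ of $\gamma'$ is $M^2$-QH and $\varphi_1$-FQC with $\varphi_1(t)=M^2t$, while for no self-homeomorphism $\varphi$ of $[0,\infty)$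 does $(*)$ hold for $D_1=D$. -/

import Mathlib

open scoped NNReal Pointwise Topology

noncomputable section

namespace FreeQC

variable {E E' : Type*} [NormedAddCommGroup E] [NormedAddCommGroup E']

/-- A domain: a non-empty, open and connected set. -/
def IsDom (D : Set E) : Prop := IsOpen D ∧ IsConnected D

/-- The distance `d_D(z)` from `z` to the boundary of `D`. -/
def bdist (D : Set E) (z : E) : ℝ := Metric.infDist z (frontier D)

/-- The distance ratio metric `j_D`. -/
def jDist (D : Set E) (x y : E) : ℝ :=
  Real.log (1 + ‖x - y‖ / min (bdist D x) (bdist D y))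

/-- The rectifiable path of length `L` whose arc length parametrization is `γ : [0, L] → D`
joins `x` to `y` in `D`. -/
def JoinsIn (D : Set E) (x y : E) (L : ℝ) (γ : ℝ → E) : Prop :=
  0 ≤ L ∧ HasUnitSpeedOn γ (Set.Icc 0 L) ∧ (∀ t ∈ Set.Icc 0 L, γ t ∈ D) ∧ γ 0 = x ∧ γ L = y

/-- The quasihyperbolic length `∫ |dz| / d_D(z)` of a path of length `L` that is parametrized
by arc length. -/
def qhLength (D : Set E) (L : ℝ) (γ : ℝ → E) : ℝ := ∫ t in (0 : ℝ)..L, 1 / bdist D (γ t)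

/-- The quasihyperbolic distance `k_D(x, y)`: the infimum of the quasihyperbolic lengths of the
rectifiable paths from `x` to `y` in `D`. -/
def qhDist (D : Set E) (x y : E) : ℝ :=
  sInf {l : ℝ | ∃ (L : ℝ) (γ : ℝ → E), JoinsIn D x y L γ ∧ l = qhLength D L γ}

/-- A growth function: a self-homeomorphism `φ` of `[0, ∞)` with `φ(t) ≥ t`. -/
def IsGrowth (φ : ℝ≥0 ≃ₜ ℝ≥0) : Prop := ∀ t, t ≤ φ t

/-- `g : G → G'` is `φ`-semisolid. -/
def IsSemisolid (φ : ℝ≥0 ≃ₜ ℝ≥0) (g : E → E') (G : Set E) (G' : Set E') : Prop :=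
  ∀ x ∈ G, ∀ y ∈ G, qhDist G' (g x) (g y) ≤ φ (qhDist G x y).toNNReal

/-- `f` restricts to a `φ`-solid homeomorphism of `D₁` onto its image `f(D₁)`. -/
def IsSolidOn (φ : ℝ≥0 ≃ₜ ℝ≥0) (f : OpenPartialHomeomorph E E') (D₁ : Set E) : Prop :=
  IsSemisolid φ f D₁ (f '' D₁) ∧ IsSemisolid φ f.symm (f '' D₁) D₁

/-- The homeomorphism `f` of the open set `f.source` onto the open set `f.target` is freely
`φ`-quasiconformal: it is `φ`-solid on every (proper) subdomain. -/
def IsFQC (φ : ℝ≥0 ≃ₜ ℝ≥0) (f : OpenPartialHomeomorph E E') : Prop :=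
  ∀ D₁ : Set E, IsDom D₁ → D₁ ⊆ f.source → D₁ ≠ Set.univ → IsSolidOn φ f D₁

/-- `f` is an `M`-quasihyperbolic homeomorphism of `f.source` onto `f.target`. -/
def IsQH (M : ℝ) (f : OpenPartialHomeomorph E E') : Prop :=
  ∀ x ∈ f.source, ∀ y ∈ f.source,
    qhDist f.source x y / M ≤ qhDist f.target (f x) (f y) ∧
      qhDist f.target (f x) (f y) ≤ M * qhDist f.source x y

/-- The two-sided distance ratio inequality
`φ⁻¹(j_{D₁}(x, y)) ≤ j_{f(D₁)}(f(x), f(y)) ≤ φ(j_{D₁}(x, y))` for all `x, y ∈ D₁`. -/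
def JIneqOn (φ : ℝ≥0 ≃ₜ ℝ≥0) (f : OpenPartialHomeomorph E E') (D₁ : Set E) : Prop :=
  ∀ x ∈ D₁, ∀ y ∈ D₁,
    (φ.symm (jDist D₁ x y).toNNReal : ℝ) ≤ jDist (f '' D₁) (f x) (f y) ∧
      jDist (f '' D₁) (f x) (f y) ≤ φ (jDist D₁ x y).toNNReal

/-- The homeomorphism `f` of `f.source` onto `f.target` is locally `M`-bilipschitz. -/
def IsLocBilip (M : ℝ) (f : OpenPartialHomeomorph E E') : Prop :=
  ∀ x ∈ f.source, ∃ U ∈ 𝓝 x, U ⊆ f.source ∧ ∀ y ∈ U, ∀ z ∈ U,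
    ‖y - z‖ / M ≤ ‖f y - f z‖ ∧ ‖f y - f z‖ ≤ M * ‖y - z‖

/-- The slit disk `B(0,1) \ [0,1)` in the complex plane. -/
def slitDisk : Set ℂ := Metric.ball 0 1 \ ((fun t : ℝ => (t : ℂ)) '' Set.Ico 0 1)

/-- `f` is a conformal mapping of the unit disk onto the slit disk. -/
def IsSlitMap (f : OpenPartialHomeomorph ℂ ℂ) : Prop :=
  f.source = Metric.ball 0 1 ∧ f.target = slitDisk ∧ DifferentiableOn ℂ f f.source

section Hilbert

variable {H : Type*} [NormedAddCommGroup H] [InnerProductSpace ℝ H]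

/-- The line spanned by `e₁`. -/
def axis (e : HilbertBasis ℤ ℝ H) : Set H := Set.range fun t : ℝ => t • e 1

/-- The tube of radius `r` about the line spanned by `e₁`. -/
def tube (e : HilbertBasis ℤ ℝ H) (r : ℝ) : Set H := axis e + Metric.ball 0 r

/-- The infinite broken line, the union of the segments `[e_{j-1}, e_j]` for `j ∈ ℤ`. -/
def brokenLine (e : HilbertBasis ℤ ℝ H) : Set H := ⋃ j : ℤ, segment ℝ (e (j - 1)) (e j)

end Hilbert

end FreeQC

end

/-!
If the distance of `f z` to the boundary controls the local stretching of `f` at `z` up to a factor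
`M`, on every subdomain and in both directions, then integration along paths shows that `f` is
`M`-quasihyperbolic and freely quasiconformal with `φ(t) = Mt`. Univalent holomorphic maps satisfy
this with `M = 24`, by a weak Koebe quarter theorem, and locally `M`-bilipschitz maps satisfy it
with `M ^ 2`.

The distance ratio metric `j` is not preserved because, unlike `k`, it does not see the shape of the
domain. The points `1 / 2 ± εi` on the two sides of the slit are `j`-close but `k`-far in the slit
disk; in the disk, which is convex, `k` is controlled by `j`, so their preimages are `j`-far.
Similarly `j` is unbounded along the axis of the tube, while it is bounded along its image, which is
bounded and keeps a positive distance from the boundary.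

The tube map transports the hyperplane orthogonal to the axis along the broken line. Consecutive
edges all meet at the same angle, and the normal hyperplanes at the vertices are related by quarter
turns; linear interpolation between the vertices gives coordinates near the broken line.
-/

noncomputable section

namespace FreeQC

open Metric Set Filter MeasureTheory

section UnitSpeed

variable {X : Type*} [PseudoMetricSpace X] {γ : ℝ → X} {s : Set ℝ}

lemma dist_le_of_hasUnitSpeedOn (h : HasUnitSpeedOn γ s) {a b : ℝ} (ha : a ∈ s) (hb : b ∈ s) :
    dist (γ a) (γ b) ≤ |a - b| := by
  wlog hab : a ≤ b generalizing a b
  · rw [dist_comm, abs_sub_comm]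
    exact this hb ha (le_of_not_ge hab)
  have hle := eVariationOn.edist_le γ (s := s ∩ Icc a b) ⟨ha, le_rfl, hab⟩ ⟨hb, hab, le_rfl⟩
  rwa [h ha hb, edist_dist, NNReal.coe_one, one_mul,
    ENNReal.ofReal_le_ofReal_iff (sub_nonneg.2 hab), ← abs_of_nonneg (sub_nonneg.2 hab),
    abs_sub_comm] at hle

lemma continuousOn_of_hasUnitSpeedOn (h : HasUnitSpeedOn γ s) : ContinuousOn γ s :=
  (LipschitzOnWith.of_dist_le_mul (K := 1) fun a ha b hb => by
    simpa [Real.dist_eq] using dist_le_of_hasUnitSpeedOn h ha hb).continuousOn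

lemma hasUnitSpeedOn_of_dist_eq (h : ∀ a ∈ s, ∀ b ∈ s, dist (γ a) (γ b) = |a - b|) :
    HasUnitSpeedOn γ s := by
  intro a ha b hb
  rw [NNReal.coe_one, one_mul]
  rcases le_or_gt a b with hab | hab
  · refine le_antisymm ?_ ?_
    · have hlip : LipschitzOnWith 1 γ (s ∩ Icc a b) := LipschitzOnWith.of_dist_le_mul
        fun p hp q hq => by simp [Real.dist_eq, h p hp.1 q hq.1]
      have hvar := hlip.comp_eVariationOn_le (g := (id : ℝ → ℝ)) fun p hp => hp
      have hid := ((monotone_id.monotoneOn s).eVariationOn_eq ha hb).le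
      simpa using hvar.trans (by simpa using hid)
    · have hdist : ENNReal.ofReal (b - a) = edist (γ a) (γ b) := by
        rw [edist_dist, h a ha b hb, abs_sub_comm, abs_of_nonneg (sub_nonneg.2 hab)]
      rw [hdist]
      exact eVariationOn.edist_le γ ⟨ha, le_rfl, hab⟩ ⟨hb, hab, le_rfl⟩
  · rw [Icc_eq_empty hab.not_ge, inter_empty, ENNReal.ofReal_of_nonpos (sub_nonpos.2 hab.le)]
    exact eVariationOn.subsingleton _ subsingleton_empty

lemma hasUnitSpeedOn_congr {γ₁ γ₂ : ℝ → X} (h : EqOn γ₁ γ₂ s) (h₂ : HasUnitSpeedOn γ₂ s) :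
    HasUnitSpeedOn γ₁ s := fun a ha b hb => by
  rw [eVariationOn.congr (h.mono inter_subset_left), h₂ ha hb]

lemma hasUnitSpeedOn_comp_sub_const {a b : ℝ} (h : HasUnitSpeedOn γ (Icc a b)) (c : ℝ) :
    HasUnitSpeedOn (fun t => γ (t - c)) (Icc (a + c) (b + c)) := by
  intro p hp q hq
  have himage : (· - c) '' (Icc (a + c) (b + c) ∩ Icc p q) = Icc a b ∩ Icc (p - c) (q - c) := by
    rw [image_inter sub_left_injective]
    simp
  have hmono : MonotoneOn (· - c) (Icc (a + c) (b + c) ∩ Icc p q) :=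
    fun _ _ _ _ hst => sub_le_sub_right hst c
  refine (eVariationOn.comp_eq_of_monotoneOn γ _ hmono).trans ?_
  rw [himage, h (sub_mem_Icc_iff_left.2 hp) (sub_mem_Icc_iff_left.2 hq), sub_sub_sub_cancel_right]

lemma hasUnitSpeedOn_comp_const_sub {a b : ℝ} (h : HasUnitSpeedOn γ (Icc a b)) (c : ℝ) :
    HasUnitSpeedOn (fun t => γ (c - t)) (Icc (c - b) (c - a)) := by
  intro p hp q hq
  have himage : (c - ·) '' (Icc (c - b) (c - a) ∩ Icc p q) = Icc a b ∩ Icc (c - q) (c - p) := by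
    rw [image_inter sub_right_injective]
    simp
  have hanti : AntitoneOn (c - ·) (Icc (c - b) (c - a) ∩ Icc p q) :=
    fun _ _ _ _ hst => sub_le_sub_left hst c
  refine (eVariationOn.comp_eq_of_antitoneOn γ _ hanti).trans ?_
  have hmem {t : ℝ} (ht : t ∈ Icc (c - b) (c - a)) : c - t ∈ Icc a b :=
    ⟨le_sub_comm.1 ht.2, sub_le_comm.1 ht.1⟩
  rw [himage, h (hmem hq) (hmem hp), sub_sub_sub_cancel_left]

end UnitSpeed

section BoundaryDistance

variable {E : Type*} [NormedAddCommGroup E]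

lemma bdist_nonneg (D : Set E) (z : E) : 0 ≤ bdist D z := infDist_nonneg

lemma continuous_bdist (D : Set E) : Continuous (bdist D) := continuous_infDist_pt _

lemma bdist_le_bdist_add_dist (D : Set E) (z w : E) : bdist D z ≤ bdist D w + dist z w :=
  infDist_le_infDist_add_dist

variable [NormedSpace ℝ E] {D : Set E} {z w : E}

lemma le_bdist_of_ball_subset {r : ℝ} (hne : D ≠ univ) (hz : z ∈ D) (h : ball z r ⊆ D) :
    r ≤ bdist D z := by
  refine (le_infDist (nonempty_frontier_iff.2 ⟨⟨z, hz⟩, hne⟩)).2 fun w hw => ?_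
  by_contra! hlt
  exact hw.2 (interior_maximal h isOpen_ball (mem_ball'.2 hlt))

lemma bdist_le_dist_of_notMem (hz : z ∈ D) (hw : w ∉ D) : bdist D z ≤ dist z w := by
  obtain ⟨p, hp, hpD⟩ : (segment ℝ z w ∩ frontier D).Nonempty := by
    by_contra! hempty
    have hsub : segment ℝ z w ⊆ interior D ∪ (closure D)ᶜ := fun p hp =>
      or_iff_not_imp_left.2 fun hint hcl =>
        (hempty.subset ⟨hp, hcl, hint⟩ : p ∈ (∅ : Set E))
    have hzint : z ∈ interior D := (hsub (left_mem_segment ℝ z w)).resolve_right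
      fun hcl => hcl (subset_closure hz)
    have hdisj : Disjoint (interior D) (closure D)ᶜ :=
      disjoint_compl_right_iff_subset.2 (interior_subset.trans subset_closure)
    exact hw (interior_subset ((convex_segment z w).isPreconnected.subset_left_of_subset_union
      isOpen_interior isClosed_closure.isOpen_compl hdisj hsub
      ⟨z, left_mem_segment ℝ z w, hzint⟩ (right_mem_segment ℝ z w)))
  calc bdist D z ≤ dist z p := infDist_le_dist_of_mem hpD
    _ ≤ dist z w := dist_add_dist_of_mem_segment hp ▸ le_add_of_nonneg_right dist_nonneg

lemma ball_bdist_subset (hz : z ∈ D) : ball z (bdist D z) ⊆ D := by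
  intro w hw
  by_contra hwD
  exact (mem_ball'.1 hw).not_ge (bdist_le_dist_of_notMem hz hwD)

lemma bdist_pos (hD : IsOpen D) (hne : D ≠ univ) (hz : z ∈ D) : 0 < bdist D z :=
  let ⟨_, hr, h⟩ := Metric.isOpen_iff.1 hD z hz
  hr.trans_le (le_bdist_of_ball_subset hne hz h)

end BoundaryDistance

section Concat

variable {X : Type*} {L : ℝ} {γ₁ γ₂ : ℝ → X}

/-- The concatenation of the path `γ₁` on `[0, L]` with the path `γ₂` on `[0, ∞)`. -/
def concat (L : ℝ) (γ₁ γ₂ : ℝ → X) (t : ℝ) : X := if t ≤ L then γ₁ t else γ₂ (t - L)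

lemma concat_of_le {t : ℝ} (ht : t ≤ L) : concat L γ₁ γ₂ t = γ₁ t := if_pos ht

lemma concat_of_ge (h : γ₁ L = γ₂ 0) {t : ℝ} (ht : L ≤ t) : concat L γ₁ γ₂ t = γ₂ (t - L) := by
  rcases ht.eq_or_lt with rfl | hlt
  · rw [concat_of_le le_rfl, h, sub_self]
  · exact if_neg hlt.not_ge

end Concat

section Paths

variable {E : Type*} [NormedAddCommGroup E] {D : Set E} {x y z : E} {L L₁ L₂ : ℝ}
  {γ γ₁ γ₂ : ℝ → E}

lemma JoinsIn.continuousOn (h : JoinsIn D x y L γ) : ContinuousOn γ (Icc 0 L) :=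
  continuousOn_of_hasUnitSpeedOn h.2.1

lemma JoinsIn.dist_le (h : JoinsIn D x y L γ) {t : ℝ} (ht : t ∈ Icc 0 L) : dist x (γ t) ≤ t := by
  obtain ⟨hL, hspeed, -, hx, -⟩ := h
  simpa [hx, abs_of_nonneg ht.1] using dist_le_of_hasUnitSpeedOn hspeed (left_mem_Icc.2 hL) ht

lemma JoinsIn.symm (h : JoinsIn D x y L γ) : JoinsIn D y x L fun t => γ (L - t) := by
  obtain ⟨hL, hspeed, hmem, hx, hy⟩ := h
  refine ⟨hL, ?_, fun t ht => hmem _ ⟨sub_nonneg.2 ht.2, sub_le_self L ht.1⟩, ?_, ?_⟩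
  · simpa using hasUnitSpeedOn_comp_const_sub hspeed L
  · simpa using hy
  · simpa using hx

lemma JoinsIn.trans (h₁ : JoinsIn D x y L₁ γ₁) (h₂ : JoinsIn D y z L₂ γ₂) :
    JoinsIn D x z (L₁ + L₂) (concat L₁ γ₁ γ₂) := by
  obtain ⟨hL₁, hspeed₁, hmem₁, hx, hy⟩ := h₁
  obtain ⟨hL₂, hspeed₂, hmem₂, hy', hz⟩ := h₂
  have hglue : γ₁ L₁ = γ₂ 0 := hy.trans hy'.symm
  refine ⟨by positivity, HasUnitSpeedOn.Icc_Icc (y := L₁) ?_ ?_, fun t ht => ?_, ?_, ?_⟩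
  · exact hasUnitSpeedOn_congr (fun t ht => concat_of_le ht.2) hspeed₁
  · refine hasUnitSpeedOn_congr (fun t ht => concat_of_ge hglue ht.1) ?_
    simpa [add_comm] using hasUnitSpeedOn_comp_sub_const hspeed₂ L₁
  · rcases le_total t L₁ with hle | hge
    · exact concat_of_le (γ₂ := γ₂) hle ▸ hmem₁ t ⟨ht.1, hle⟩
    · rw [concat_of_ge hglue hge]
      exact hmem₂ _ ⟨sub_nonneg.2 hge, sub_le_iff_le_add'.2 ht.2⟩
  · rw [concat_of_le hL₁, hx]
  · rw [concat_of_ge hglue (le_add_of_nonneg_right hL₂), add_sub_cancel_left, hz]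

variable [NormedSpace ℝ E]

lemma exists_joinsIn_of_segment_subset (h : segment ℝ x y ⊆ D) :
    ∃ γ : ℝ → E, JoinsIn D x y ‖x - y‖ γ ∧ ∀ t ∈ Icc 0 ‖x - y‖, γ t ∈ segment ℝ x y := by
  rcases eq_or_ne x y with rfl | hxy
  · refine ⟨fun _ => x, ⟨norm_nonneg _, ?_, fun _ _ => h (left_mem_segment ℝ x x), rfl, rfl⟩,
      fun _ _ => left_mem_segment ℝ x x⟩
    rw [sub_self, norm_zero, Icc_self]
    exact hasConstantSpeedOnWith_of_subsingleton _ subsingleton_singleton _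
  · have hpos : 0 < ‖x - y‖ := norm_sub_pos_iff.2 hxy
    have hmem : ∀ t ∈ Icc 0 ‖x - y‖, x + (t / ‖x - y‖) • (y - x) ∈ segment ℝ x y := fun t ht => by
      rw [segment_eq_image']
      exact ⟨_, ⟨div_nonneg ht.1 hpos.le, (div_le_one hpos).2 ht.2⟩, rfl⟩
    refine ⟨fun t => x + (t / ‖x - y‖) • (y - x), ⟨hpos.le, ?_, fun t ht => h (hmem t ht), ?_, ?_⟩,
      hmem⟩
    · refine hasUnitSpeedOn_of_dist_eq fun s _ t _ => ?_
      rw [dist_add_left, dist_eq_norm, ← sub_smul, norm_smul, ← sub_div, norm_div, norm_norm,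
        norm_sub_rev y x, div_mul_cancel₀ _ hpos.ne', Real.norm_eq_abs]
    · simp
    · simp [div_self hpos.ne']

lemma exists_joinsIn (hD : IsDom D) (hx : x ∈ D) (hy : y ∈ D) : ∃ L γ, JoinsIn D x y L γ := by
  refine hD.2.isPreconnected.induction₂ (fun x y => ∃ L γ, JoinsIn D x y L γ) (fun x hx => ?_)
    (fun x y z _ _ _ ⟨L₁, γ₁, h₁⟩ ⟨L₂, γ₂, h₂⟩ => ⟨_, _, h₁.trans h₂⟩)
    (fun x y _ _ ⟨L, γ, h⟩ => ⟨_, _, h.symm⟩) hx hy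
  obtain ⟨r, hr, hball⟩ := Metric.isOpen_iff.1 hD.1 x hx
  filter_upwards [mem_nhdsWithin_of_mem_nhds (ball_mem_nhds x hr)] with y hy
  obtain ⟨γ, hγ, -⟩ := exists_joinsIn_of_segment_subset
    (((convex_ball x r).segment_subset (mem_ball_self hr) hy).trans hball)
  exact ⟨_, γ, hγ⟩

end Paths

section QuasihyperbolicLength

variable {E : Type*} [NormedAddCommGroup E] {D : Set E} {x y z : E} {L L₁ L₂ : ℝ}
  {γ γ₁ γ₂ : ℝ → E}

lemma qhLength_nonneg (D : Set E) (γ : ℝ → E) (hL : 0 ≤ L) : 0 ≤ qhLength D L γ :=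
  intervalIntegral.integral_nonneg hL fun _ _ => one_div_nonneg.2 (bdist_nonneg _ _)

lemma qhLength_comp_const_sub (D : Set E) (L : ℝ) (γ : ℝ → E) :
    qhLength D L (fun t => γ (L - t)) = qhLength D L γ := by
  rw [qhLength, intervalIntegral.integral_comp_sub_left (fun t => 1 / bdist D (γ t)), sub_self,
    sub_zero, qhLength]

variable [NormedSpace ℝ E]

lemma JoinsIn.continuousOn_one_div_bdist (h : JoinsIn D x y L γ) (hD : IsOpen D) (hne : D ≠ univ) :
    ContinuousOn (fun t => 1 / bdist D (γ t)) (Icc 0 L) :=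
  continuousOn_const.div ((continuous_bdist D).comp_continuousOn h.continuousOn)
    fun t ht => (bdist_pos hD hne (h.2.2.1 t ht)).ne'

lemma JoinsIn.intervalIntegrable (h : JoinsIn D x y L γ) (hD : IsOpen D) (hne : D ≠ univ)
    {a b : ℝ} (ha : a ∈ Icc 0 L) (hb : b ∈ Icc 0 L) :
    IntervalIntegrable (fun t => 1 / bdist D (γ t)) volume a b :=
  ((h.continuousOn_one_div_bdist hD hne).mono
    (ordConnected_Icc.uIcc_subset ha hb)).intervalIntegrable

lemma JoinsIn.qhLength_concat (hD : IsOpen D) (hne : D ≠ univ) (h₁ : JoinsIn D x y L₁ γ₁)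
    (h₂ : JoinsIn D y z L₂ γ₂) :
    qhLength D (L₁ + L₂) (concat L₁ γ₁ γ₂) = qhLength D L₁ γ₁ + qhLength D L₂ γ₂ := by
  have hL₁ := h₁.1
  have hle : L₁ ≤ L₁ + L₂ := le_add_of_nonneg_right h₂.1
  have hglue : γ₁ L₁ = γ₂ 0 := h₁.2.2.2.2.trans h₂.2.2.2.1.symm
  have hmid : L₁ ∈ Icc 0 (L₁ + L₂) := ⟨hL₁, hle⟩
  have hconcat := h₁.trans h₂
  rw [qhLength, ← intervalIntegral.integral_add_adjacent_intervals
    (hconcat.intervalIntegrable hD hne (left_mem_Icc.2 hconcat.1) hmid)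
    (hconcat.intervalIntegrable hD hne hmid (right_mem_Icc.2 hconcat.1))]
  congr 1
  · refine intervalIntegral.integral_congr fun t ht => ?_
    rw [uIcc_of_le hL₁] at ht
    simp only [concat_of_le ht.2]
  · calc ∫ t in L₁..(L₁ + L₂), 1 / bdist D (concat L₁ γ₁ γ₂ t)
        = ∫ t in L₁..(L₁ + L₂), 1 / bdist D (γ₂ (t - L₁)) := by
          refine intervalIntegral.integral_congr fun t ht => ?_
          rw [uIcc_of_le hle] at ht
          simp only [concat_of_ge hglue ht.1]
      _ = qhLength D L₂ γ₂ := by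
          rw [intervalIntegral.integral_comp_sub_right (fun t => 1 / bdist D (γ₂ t)), sub_self,
            add_sub_cancel_left, qhLength]

lemma integral_one_div_const_add {d ρ : ℝ} (hd : 0 < d) (hρ : 0 ≤ ρ) :
    ∫ t in (0 : ℝ)..ρ, 1 / (d + t) = Real.log (1 + ρ / d) := by
  rw [intervalIntegral.integral_comp_add_left (fun u : ℝ => 1 / u) d,
    integral_one_div_of_pos (by positivity) (by positivity), add_zero, add_div, div_self hd.ne']

lemma JoinsIn.log_one_add_div_le_qhLength (h : JoinsIn D x y L γ) (hD : IsOpen D) (hne : D ≠ univ)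
    {t ρ : ℝ} (ht : t ∈ Icc 0 L) (hρ : 0 ≤ ρ) (hfar : ρ ≤ dist x (γ t)) :
    Real.log (1 + ρ / bdist D x) ≤ qhLength D L γ := by
  have hL := h.1
  have hpos : 0 < bdist D x := bdist_pos hD hne (h.2.2.2.1 ▸ h.2.2.1 0 (left_mem_Icc.2 hL))
  have hρL : ρ ∈ Icc 0 L := ⟨hρ, hfar.trans ((h.dist_le ht).trans ht.2)⟩
  have hint := h.intervalIntegrable hD hne (left_mem_Icc.2 hL) hρL
  have hcont : ContinuousOn (fun s => 1 / (bdist D x + s)) (uIcc 0 ρ) := by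
    refine continuousOn_const.div (by fun_prop) fun s hs => ?_
    rw [uIcc_of_le hρ] at hs
    linarith [hs.1]
  rw [← integral_one_div_const_add hpos hρ, qhLength,
    ← intervalIntegral.integral_add_adjacent_intervals hint
      (h.intervalIntegrable hD hne hρL (right_mem_Icc.2 hL))]
  refine le_add_of_le_of_nonneg
    (intervalIntegral.integral_mono_on hρ hcont.intervalIntegrable hint fun s hs => ?_)
    (intervalIntegral.integral_nonneg hρL.2 fun _ _ => one_div_nonneg.2 (bdist_nonneg _ _))
  have hsL : s ∈ Icc 0 L := ⟨hs.1, hs.2.trans hρL.2⟩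
  refine one_div_le_one_div_of_le (bdist_pos hD hne (h.2.2.1 s hsL)) ?_
  calc bdist D (γ s) ≤ bdist D x + dist (γ s) x := bdist_le_bdist_add_dist D _ _
    _ ≤ bdist D x + s := by rw [dist_comm]; gcongr; exact h.dist_le hsL

end QuasihyperbolicLength

section QuasihyperbolicDistance

variable {E : Type*} [NormedAddCommGroup E] {D : Set E} {x y z : E}

lemma qhDist_nonneg (D : Set E) (x y : E) : 0 ≤ qhDist D x y :=
  Real.sInf_nonneg (by rintro _ ⟨L, γ, h, rfl⟩; exact qhLength_nonneg D γ h.1)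

lemma qhDist_le_qhLength {L : ℝ} {γ : ℝ → E} (h : JoinsIn D x y L γ) :
    qhDist D x y ≤ qhLength D L γ := by
  refine csInf_le ⟨0, ?_⟩ ⟨L, γ, h, rfl⟩
  rintro _ ⟨L, γ, h, rfl⟩
  exact qhLength_nonneg D γ h.1

lemma qhDist_comm (D : Set E) (x y : E) : qhDist D x y = qhDist D y x := by
  have hsub (x y : E) : {l | ∃ L γ, JoinsIn D x y L γ ∧ l = qhLength D L γ} ⊆
      {l | ∃ L γ, JoinsIn D y x L γ ∧ l = qhLength D L γ} := by
    rintro _ ⟨L, γ, h, rfl⟩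
    exact ⟨L, _, h.symm, (qhLength_comp_const_sub D L γ).symm⟩
  exact congrArg sInf ((hsub x y).antisymm (hsub y x))

variable [NormedSpace ℝ E]

lemma le_qhDist (hD : IsDom D) (hx : x ∈ D) (hy : y ∈ D) {c : ℝ}
    (h : ∀ L γ, JoinsIn D x y L γ → c ≤ qhLength D L γ) : c ≤ qhDist D x y := by
  obtain ⟨L, γ, hγ⟩ := exists_joinsIn hD hx hy
  refine le_csInf ⟨_, L, γ, hγ, rfl⟩ ?_
  rintro _ ⟨L, γ, hγ, rfl⟩
  exact h L γ hγ

lemma qhDist_triangle (hD : IsDom D) (hne : D ≠ univ) (hx : x ∈ D) (hy : y ∈ D) (hz : z ∈ D) :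
    qhDist D x z ≤ qhDist D x y + qhDist D y z := by
  rw [← sub_le_iff_le_add]
  refine le_qhDist hD hx hy fun L₁ γ₁ h₁ => ?_
  rw [sub_le_comm]
  refine le_qhDist hD hy hz fun L₂ γ₂ h₂ => ?_
  rw [sub_le_iff_le_add', ← h₁.qhLength_concat hD.1 hne h₂]
  exact qhDist_le_qhLength (h₁.trans h₂)

lemma qhDist_le_of_segment (hD : IsOpen D) (hne : D ≠ univ) {m : ℝ} (hm : 0 < m)
    (hseg : segment ℝ x y ⊆ D) (hbd : ∀ p ∈ segment ℝ x y, m ≤ bdist D p) :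
    qhDist D x y ≤ ‖x - y‖ / m := by
  obtain ⟨γ, hγ, hmem⟩ := exists_joinsIn_of_segment_subset hseg
  have hL := hγ.1
  calc qhDist D x y ≤ ∫ t in (0 : ℝ)..‖x - y‖, 1 / bdist D (γ t) := qhDist_le_qhLength hγ
    _ ≤ ∫ _ in (0 : ℝ)..‖x - y‖, 1 / m :=
        intervalIntegral.integral_mono_on hL
          (hγ.intervalIntegrable hD hne (left_mem_Icc.2 hL) (right_mem_Icc.2 hL))
          intervalIntegrable_const fun t ht => one_div_le_one_div_of_le hm (hbd _ (hmem t ht))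
    _ = ‖x - y‖ / m := by
        rw [intervalIntegral.integral_const, sub_zero, smul_eq_mul, mul_one_div]

lemma qhDist_self (hD : IsOpen D) (hne : D ≠ univ) (hx : x ∈ D) : qhDist D x x = 0 := by
  refine le_antisymm ?_ (qhDist_nonneg D x x)
  simpa using qhDist_le_of_segment (x := x) (y := x) hD hne (bdist_pos hD hne hx)
    (by simpa using hx) (by simp)

lemma eventually_qhDist_le (hD : IsOpen D) (hne : D ≠ univ) (hx : x ∈ D) {c : ℝ}
    (hc : 1 / bdist D x < c) : ∀ᶠ y in 𝓝 x, qhDist D x y ≤ c * ‖x - y‖ := by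
  have hpos := bdist_pos hD hne hx
  have hc0 : 0 < c := (one_div_pos.2 hpos).trans hc
  have hlt : c⁻¹ < bdist D x := (one_div c).symm ▸ (one_div_lt hpos hc0).1 hc
  filter_upwards [ball_mem_nhds x (sub_pos.2 hlt)] with y hy
  have hnear : ∀ p ∈ segment ℝ x y, dist x p ≤ bdist D x - c⁻¹ := fun p hp => by
    have := dist_add_dist_of_mem_segment hp
    linarith [dist_nonneg (x := p) (y := y), mem_ball'.1 hy]
  have hbound := qhDist_le_of_segment (m := c⁻¹) hD hne (inv_pos.2 hc0) (y := y)
    (fun p hp => ball_bdist_subset hx (mem_ball'.2 ((hnear p hp).trans_lt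
      (sub_lt_self _ (inv_pos.2 hc0))))) fun p hp => by
        linarith [hnear p hp, bdist_le_bdist_add_dist D x p]
  rwa [div_inv_eq_mul, mul_comm] at hbound

lemma continuousOn_qhDist (hD : IsDom D) (hne : D ≠ univ) (hx : x ∈ D) :
    ContinuousOn (qhDist D x) D := by
  refine fun p hp => ContinuousAt.continuousWithinAt ?_
  obtain ⟨c, hc⟩ := exists_gt (1 / bdist D p)
  have hlim : Tendsto (fun q => c * ‖p - q‖) (𝓝 p) (𝓝 0) := by
    have : Continuous fun q => c * ‖p - q‖ := by fun_prop
    simpa using this.tendsto p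
  rw [ContinuousAt, tendsto_iff_dist_tendsto_zero]
  refine squeeze_zero' (Eventually.of_forall fun _ => dist_nonneg) ?_ hlim
  filter_upwards [eventually_qhDist_le hD.1 hne hp hc, hD.1.mem_nhds hp] with q hq hqD
  have hpq := qhDist_triangle hD hne hx hp hqD
  have hqp := qhDist_triangle hD hne hx hqD hp
  rw [qhDist_comm D q p] at hqp
  rw [Real.dist_eq, abs_le]
  constructor <;> linarith

end QuasihyperbolicDistance

lemma sub_le_integral_of_eventually_sub_le {F u : ℝ → ℝ} {a b : ℝ} (hab : a ≤ b)
    (hF : ContinuousOn F (Icc a b)) (hu : ContinuousOn u (Icc a b))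
    (h : ∀ t ∈ Ico a b, ∀ r > u t, ∀ᶠ s in 𝓝[>] t, F s - F t ≤ r * (s - t)) :
    F b - F a ≤ ∫ t in a..b, u t := by
  set v : ℝ → ℝ := IccExtend hab ((Icc a b).domRestrict u)
  have hv : Continuous v := (continuousOn_iff_continuous_domRestrict.1 hu).Icc_extend'
  have hvu : ∀ t ∈ Icc a b, v t = u t := fun t ht => IccExtend_of_mem hab _ ht
  have hderiv (t : ℝ) : HasDerivAt (fun t => F a + ∫ s in a..t, v s) (v t) t :=
    (intervalIntegral.integral_hasDerivAt_right (hv.intervalIntegrable _ _)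
      (hv.stronglyMeasurableAtFilter _ _) hv.continuousAt).const_add _
  have hle : F b ≤ F a + ∫ s in a..b, v s :=
    image_le_of_liminf_slope_right_le_deriv_boundary hF (by simp)
      (fun t _ => (hderiv t).continuousAt.continuousWithinAt)
      (fun t _ => (hderiv t).hasDerivWithinAt) (fun t ht r hr => by
        obtain ⟨r', hr', hlt⟩ := exists_between hr
        rw [hvu t (Ico_subset_Icc_self ht)] at hr'
        refine Eventually.frequently ?_
        filter_upwards [h t ht r' hr', self_mem_nhdsWithin] with s hs hts
        have hpos : 0 < s - t := sub_pos.2 hts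
        rw [slope_def_field, div_lt_iff₀ hpos]
        exact hs.trans_lt (mul_lt_mul_of_pos_right hlt hpos)) (right_mem_Icc.2 hab)
  rw [sub_le_iff_le_add']
  refine hle.trans_eq (congrArg _ (intervalIntegral.integral_congr fun t ht => hvu t ?_))
  rwa [uIcc_of_le hab] at ht

section Dilatation

variable {E : Type*} [NormedAddCommGroup E] {D : Set E}
variable {E' : Type*} [NormedAddCommGroup E'] {D' : Set E'}
variable {g : E → E'} {M : ℝ}

/-- The quasihyperbolic dilatation of `g : D → D'` is at most `M` at every point: the upper
derivative of `g` at `x`, multiplied by the quotient `d_D(x) / d_{D'}(g(x))` of the quasihyperbolic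
densities, is at most `M`. It is written with an arbitrary larger local Lipschitz constant `K` in
place of the upper derivative. -/
def DilatationLE (M : ℝ) (g : E → E') (D : Set E) (D' : Set E') : Prop :=
  ∀ x ∈ D, ∀ K, M * bdist D' (g x) / bdist D x < K → ∀ᶠ y in 𝓝 x, ‖g y - g x‖ ≤ K * ‖y - x‖

lemma DilatationLE.continuousAt (hg : DilatationLE M g D D') {x : E} (hx : x ∈ D) :
    ContinuousAt g x := by
  obtain ⟨K, hK⟩ := exists_gt (M * bdist D' (g x) / bdist D x)
  have hlim : Tendsto (fun y => K * ‖y - x‖) (𝓝 x) (𝓝 0) := by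
    have : Continuous fun y => K * ‖y - x‖ := by fun_prop
    simpa using this.tendsto x
  rw [ContinuousAt, tendsto_iff_norm_sub_tendsto_zero]
  exact squeeze_zero' (Eventually.of_forall fun _ => norm_nonneg _) (hg x hx K hK) hlim

variable [NormedSpace ℝ E] [NormedSpace ℝ E']

lemma DilatationLE.eventually_qhDist_le_mul (hg : DilatationLE M g D D') (hD : IsOpen D)
    (hne : D ≠ univ) (hD' : IsOpen D') (hne' : D' ≠ univ) (hM : 0 ≤ M) {x : E} (hx : x ∈ D)
    (hgx : g x ∈ D') {r : ℝ} (hr : M / bdist D x < r) :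
    ∀ᶠ y in 𝓝 x, qhDist D' (g x) (g y) ≤ r * ‖x - y‖ := by
  have hd := bdist_pos hD hne hx
  have hd' := bdist_pos hD' hne' hgx
  obtain ⟨K, hK, hKr⟩ : ∃ K, M * bdist D' (g x) / bdist D x < K ∧ K < r * bdist D' (g x) := by
    refine exists_between ?_
    rw [mul_div_right_comm]
    exact mul_lt_mul_of_pos_right hr hd'
  have hr0 : 0 < r := (div_nonneg hM hd.le).trans_lt hr
  have hK0 : 0 < K := (by positivity : 0 ≤ M * bdist D' (g x) / bdist D x).trans_lt hK
  have hc : 1 / bdist D' (g x) < r / K := by rwa [div_lt_div_iff₀ hd' hK0, one_mul]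
  filter_upwards [hg x hx K hK,
    (hg.continuousAt hx).eventually (eventually_qhDist_le hD' hne' hgx hc)] with y hy hqh
  calc qhDist D' (g x) (g y) ≤ r / K * ‖g x - g y‖ := hqh
    _ ≤ r / K * (K * ‖x - y‖) := by
        rw [norm_sub_rev (g x), norm_sub_rev x]
        gcongr
    _ = r * ‖x - y‖ := by field_simp

theorem DilatationLE.qhDist_le (hg : DilatationLE M g D D') (hD : IsDom D) (hne : D ≠ univ)
    (hD' : IsDom D') (hne' : D' ≠ univ) (hmap : MapsTo g D D') (hM : 0 < M) {x y : E} (hx : x ∈ D)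
    (hy : y ∈ D) : qhDist D' (g x) (g y) ≤ M * qhDist D x y := by
  rw [← div_le_iff₀' hM]
  refine le_qhDist hD hx hy fun L γ hγ => ?_
  have hcont := hγ.continuousOn
  have hdensity := hγ.continuousOn_one_div_bdist hD.1 hne
  obtain ⟨hL, hspeed, hγD, h0, hend⟩ := hγ
  have hgγ : ContinuousOn (fun t => g (γ t)) (Icc 0 L) := fun t ht =>
    (hg.continuousAt (hγD t ht)).comp_continuousWithinAt (hcont t ht)
  have hgrowth : ∀ t ∈ Ico 0 L, ∀ r > M * (1 / bdist D (γ t)), ∀ᶠ s in 𝓝[>] t,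
      qhDist D' (g x) (g (γ s)) - qhDist D' (g x) (g (γ t)) ≤ r * (s - t) := by
    intro t ht r hr
    rw [mul_one_div] at hr
    have htL : t ∈ Icc 0 L := Ico_subset_Icc_self ht
    have hp := hγD t htL
    have hr0 : 0 < r := (div_pos hM (bdist_pos hD.1 hne hp)).trans hr
    have hlim : Tendsto γ (𝓝[>] t) (𝓝 (γ t)) := by
      refine (hcont t htL).mono_left ?_
      rw [← nhdsWithin_Ioo_eq_nhdsGT ht.2]
      exact nhdsWithin_mono _ fun s hs => ⟨ht.1.trans hs.1.le, hs.2.le⟩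
    filter_upwards [Ioo_mem_nhdsGT ht.2, hlim.eventually
      (hg.eventually_qhDist_le_mul hD.1 hne hD'.1 hne' hM.le hp (hmap hp) hr)] with s hs hqh
    have hsL : s ∈ Icc 0 L := ⟨ht.1.trans hs.1.le, hs.2.le⟩
    have hstep : ‖γ t - γ s‖ ≤ s - t := by
      simpa [dist_eq_norm, abs_sub_comm t, abs_of_pos (sub_pos.2 hs.1)] using
        dist_le_of_hasUnitSpeedOn hspeed htL hsL
    have htri := qhDist_triangle hD' hne' (hmap hx) (hmap hp) (hmap (hγD s hsL))
    linarith [mul_le_mul_of_nonneg_left hstep hr0.le]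
  have hint := sub_le_integral_of_eventually_sub_le hL
    ((continuousOn_qhDist hD' hne' (hmap hx)).comp hgγ fun t ht => hmap (hγD t ht))
    (continuousOn_const.mul hdensity) hgrowth
  rw [div_le_iff₀' hM]
  simpa [h0, hend, qhDist_self hD'.1 hne' (hmap hx), qhLength] using hint

end Dilatation

section FullyQuasihyperbolic

variable {E E' : Type*} [NormedAddCommGroup E] [NormedAddCommGroup E']
variable {f : OpenPartialHomeomorph E E'} {M : ℝ}

/-- `f` is fully `M`-quasihyperbolic: its restriction to each proper subdomain of its source is
`M`-quasihyperbolic. -/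
def IsFullyQH (M : ℝ) (f : OpenPartialHomeomorph E E') : Prop :=
  ∀ D₁ : Set E, IsDom D₁ → D₁ ⊆ f.source → D₁ ≠ univ → ∀ x ∈ D₁, ∀ y ∈ D₁,
    qhDist (f '' D₁) (f x) (f y) ≤ M * qhDist D₁ x y ∧
      qhDist D₁ x y ≤ M * qhDist (f '' D₁) (f x) (f y)

lemma IsFullyQH.isQH (hf : IsFullyQH M f) (hM : 0 < M) (hD : IsDom f.source)
    (hne : f.source ≠ univ) : IsQH M f := fun x hx y hy => by
  obtain ⟨hle, hge⟩ := hf f.source hD subset_rfl hne x hx y hy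
  rw [f.image_source_eq_target] at hle hge
  exact ⟨(div_le_iff₀' hM).2 hge, hle⟩

lemma exists_isGrowth_eq_mul (hM : 1 ≤ M) :
    ∃ φ : ℝ≥0 ≃ₜ ℝ≥0, IsGrowth φ ∧ ∀ t : ℝ≥0, (φ t : ℝ) = M * t := by
  lift M to ℝ≥0 using zero_le_one.trans hM
  norm_cast at hM
  exact ⟨Homeomorph.mulLeft₀ M (one_pos.trans_le hM).ne', fun t => le_mul_of_one_le_left' hM,
    fun t => NNReal.coe_mul M t⟩

lemma IsFullyQH.isFQC (hf : IsFullyQH M f) {φ : ℝ≥0 ≃ₜ ℝ≥0} (hφ : ∀ t : ℝ≥0, (φ t : ℝ) = M * t) :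
    IsFQC φ f := by
  intro D₁ hD₁ hsub hne
  simp only [IsSolidOn, IsSemisolid, hφ, Real.coe_toNNReal _ (qhDist_nonneg _ _ _),
    forall_mem_image]
  refine ⟨fun x hx y hy => (hf D₁ hD₁ hsub hne x hx y hy).1, fun x hx y hy => ?_⟩
  rw [f.left_inv (hsub hx), f.left_inv (hsub hy)]
  exact (hf D₁ hD₁ hsub hne x hx y hy).2

lemma IsFullyQH.exists_isGrowth_isFQC (hf : IsFullyQH M f) (hM : 1 ≤ M) :
    ∃ φ : ℝ≥0 ≃ₜ ℝ≥0, IsGrowth φ ∧ (∀ t : ℝ≥0, (φ t : ℝ) = M * t) ∧ IsFQC φ f :=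
  let ⟨φ, hφ, hlin⟩ := exists_isGrowth_eq_mul hM
  ⟨φ, hφ, hlin, hf.isFQC hlin⟩

lemma isDom_image {D₁ : Set E} (hD₁ : IsDom D₁) (hsub : D₁ ⊆ f.source) : IsDom (f '' D₁) :=
  ⟨f.isOpen_image_of_subset_source hD₁.1 hsub, hD₁.2.image _ (f.continuousOn.mono hsub)⟩

lemma isFullyQH_of_dilatationLE [NormedSpace ℝ E] [NormedSpace ℝ E'] (hM : 0 < M)
    (hne' : f.target ≠ univ)
    (h : ∀ D₁ : Set E, IsDom D₁ → D₁ ⊆ f.source → D₁ ≠ univ → DilatationLE M f D₁ (f '' D₁))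
    (h' : ∀ D₁ : Set E', IsDom D₁ → D₁ ⊆ f.target → D₁ ≠ univ →
      DilatationLE M f.symm D₁ (f.symm '' D₁)) :
    IsFullyQH M f := by
  intro D₁ hD₁ hsub hne x hx y hy
  have himg := isDom_image hD₁ hsub
  have hsub' : f '' D₁ ⊆ f.target := f.image_source_eq_target ▸ image_mono hsub
  have hne₁ : f '' D₁ ≠ univ := fun h => hne' (univ_subset_iff.1 (h ▸ hsub'))
  have hinv : f.symm '' (f '' D₁) = D₁ := f.symm_image_image_of_subset_source hsub
  refine ⟨(h D₁ hD₁ hsub hne).qhDist_le hD₁ hne himg hne₁ (mapsTo_image f D₁) hM hx hy, ?_⟩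
  have hback := (h' _ himg hsub' hne₁).qhDist_le himg hne₁ (by rwa [hinv]) (by rwa [hinv])
    (mapsTo_image _ _) hM (mem_image_of_mem f hx) (mem_image_of_mem f hy)
  rwa [hinv, f.left_inv (hsub hx), f.left_inv (hsub hy)] at hback

end FullyQuasihyperbolic

section Univalent

lemma hasDerivAt_of_sq_eq {g h : ℂ → ℂ} {z g' : ℂ} (hg : HasDerivAt g g' z)
    (hc : ContinuousAt h z) (hsq : ∀ᶠ ζ in 𝓝 z, h ζ ^ 2 = g ζ) (hz : h z ≠ 0) :
    HasDerivAt h (g' / (2 * h z)) z := by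
  have hpow : HasDerivAt (· ^ 2) (2 * h z) (h z) := by simpa using hasDerivAt_pow 2 (h z)
  have hne : 2 * h z ≠ 0 := mul_ne_zero two_ne_zero hz
  let e := ContinuousLinearEquiv.unitsEquivAut ℂ (Units.mk0 _ hne)
  have := HasFDerivAt.of_comp_of_leftInverse (f'symm := (e.symm : ℂ →L[ℂ] ℂ)) hc
    (hpow.hasFDerivAt_equiv hne) hg.hasFDerivAt hsq e.symm_apply_apply
  simpa [e, div_eq_mul_inv] using this.hasDerivAt

variable {f : OpenPartialHomeomorph ℂ ℂ} {g h : ℂ → ℂ} {z w : ℂ} {R : ℝ}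

lemma exists_continuousOn_sq_eq_sub (hR : 0 < R) (hg : ContinuousOn g (ball z R))
    (hw : w ∉ g '' ball z R) : ∃ h : ℂ → ℂ, ContinuousOn h (ball z R) ∧ ∀ ζ, h ζ ^ 2 = g ζ - w := by
  have : ContractibleSpace (ball z R) := contractibleSpace_ball hR
  refine Complex.exists_continuousOn_pow_eq (inferInstance : SimplyConnectedSpace (ball z R))
    isOpen_ball (hg.sub continuousOn_const) ?_ two_ne_zero
  rintro ⟨ζ, hζ, h0⟩
  exact hw ⟨ζ, hζ, sub_eq_zero.1 h0⟩

lemma sq_add_mem_ball (hz : h z ^ 2 = g z - w) {u : ℂ} (hu : u ∈ ball (h z) (2 / 5 * ‖h z‖)) :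
    u ^ 2 + w ∈ ball (g z) (‖h z‖ ^ 2) := by
  rw [mem_ball, dist_eq_norm] at hu ⊢
  have hsum : ‖(u - h z) + 2 * h z‖ ≤ ‖u - h z‖ + 2 * ‖h z‖ := by
    simpa using norm_add_le (u - h z) (2 * h z)
  have hfactor : u ^ 2 + w - g z = (u - h z) * ((u - h z) + 2 * h z) := by
    linear_combination hz
  rw [hfactor, norm_mul]
  nlinarith [norm_nonneg (u - h z), norm_nonneg ((u - h z) + 2 * h z)]

/- On the ball the section `u ↦ h (f⁻¹ (u² + w))` of `h` is a branch of `√(u²)` that fixes the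
centre, hence it is the identity. -/
lemma ball_subset_image_of_sq_eq_sub (hz : ball z R ⊆ f.source) (hR : 0 < R)
    (hc : ContinuousOn h (ball z R)) (hsq : ∀ ζ, h ζ ^ 2 = f ζ - w) (hz0 : h z ≠ 0)
    (hball : ball (f z) (‖h z‖ ^ 2) ⊆ f '' ball z R) :
    ball (h z) (2 / 5 * ‖h z‖) ⊆ h '' ball z R := by
  set B := ball (h z) (2 / 5 * ‖h z‖)
  have hpos : 0 < ‖h z‖ := norm_pos_iff.2 hz0
  have hmaps : MapsTo (fun u : ℂ => u ^ 2 + w) B (f '' ball z R) :=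
    fun u hu => hball (sq_add_mem_ball (hsq z) hu)
  have hsub : f '' ball z R ⊆ f.target := f.image_source_eq_target ▸ image_mono hz
  have hsymm : MapsTo f.symm (f '' ball z R) (ball z R) := by
    rintro _ ⟨ζ, hζ, rfl⟩
    rwa [f.left_inv (hz hζ)]
  have hcont : ContinuousOn (fun u => h (f.symm (u ^ 2 + w))) B :=
    hc.comp ((f.continuousOn_symm.mono hsub).comp (by fun_prop) hmaps) (hsymm.comp hmaps)
  have hsection : EqOn (fun u => h (f.symm (u ^ 2 + w))) id B := by
    refine (convex_ball _ _).isPreconnected.eq_of_sq_eq hcont continuousOn_id (fun u hu => ?_)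
      (fun {u} hu h0 => ?_) (mem_ball_self (by positivity)) ?_
    · simp [hsq, f.right_inv (hsub (hmaps hu))]
    · obtain rfl : u = 0 := h0
      rw [mem_ball, dist_zero_left] at hu
      linarith
    · simp [hsq, f.left_inv (hz (mem_ball_self hR))]
  exact fun u hu => ⟨_, hsymm (hmaps hu), hsection hu⟩

lemma le_norm_add_of_sq_eq_sub (hg : InjOn g (ball z R)) (hsq : ∀ ζ, h ζ ^ 2 = g ζ - w)
    (hne : ∀ ζ ∈ ball z R, h ζ ≠ 0) {r : ℝ} (hball : ball (h z) r ⊆ h '' ball z R) {ζ : ℂ}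
    (hζ : ζ ∈ ball z R) : r ≤ ‖h ζ + h z‖ := by
  by_contra! hlt
  obtain ⟨ζ', hζ', hneg⟩ : -h ζ ∈ h '' ball z R := hball <| by
    rwa [mem_ball, dist_eq_norm, ← neg_add', norm_neg]
  have hsame : g ζ' = g ζ := by
    have := hsq ζ'
    rw [hneg, neg_sq, hsq] at this
    exact (sub_left_injective this).symm
  rw [hg hζ' hζ hsame, self_eq_neg] at hneg
  exact hne ζ hζ hneg

lemma norm_deriv_mul_le_of_le_norm_add (hd : DifferentiableOn ℂ h (ball z R)) (hR : 0 < R)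
    (hz0 : h z ≠ 0) {c : ℝ} (hc : 0 < c)
    (hfar : ∀ ζ ∈ ball z R, c * ‖h z‖ ≤ ‖h ζ + h z‖) :
    ‖deriv h z‖ * R ≤ 4 * (1 / c + 1 / 2) * ‖h z‖ := by
  have hpos : 0 < ‖h z‖ := norm_pos_iff.2 hz0
  have hne : ∀ ζ ∈ ball z R, h ζ + h z ≠ 0 := fun ζ hζ =>
    norm_pos_iff.1 ((mul_pos hc hpos).trans_le (hfar ζ hζ))
  have hzz : ‖(h z + h z)⁻¹‖ = 1 / 2 / ‖h z‖ := by
    rw [← two_mul, norm_inv, norm_mul, Complex.norm_two]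
    field_simp
  have hmaps : MapsTo (fun ζ => (h ζ + h z)⁻¹) (ball z R)
      (closedBall (h z + h z)⁻¹ ((1 / c + 1 / 2) / ‖h z‖)) := fun ζ hζ => by
    have hinv : ‖(h ζ + h z)⁻¹‖ ≤ 1 / c / ‖h z‖ := by
      rw [norm_inv, div_div, one_div]
      exact inv_anti₀ (by positivity) (hfar ζ hζ)
    rw [mem_closedBall, dist_eq_norm, add_div, ← hzz]
    exact (norm_sub_le _ _).trans (by gcongr)
  have hderiv : HasDerivAt (fun ζ => (h ζ + h z)⁻¹) (-deriv h z / (h z + h z) ^ 2) z :=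
    ((hd.hasDerivAt (ball_mem_nhds z hR)).add_const _).fun_inv (hne z (mem_ball_self hR))
  have hschwarz := Complex.norm_deriv_le_div_of_mapsTo_ball
    ((hd.add_const _).fun_inv hne) hmaps hR
  rw [hderiv.deriv, ← two_mul, norm_div, norm_neg, norm_pow, norm_mul, Complex.norm_two, div_div,
    div_le_div_iff₀ (by positivity) (by positivity)] at hschwarz
  refine le_of_mul_le_mul_right (hschwarz.trans_eq' (by ring) |>.trans_eq ?_) hpos
  ring

/- A weak form of the Koebe quarter theorem. With `w` a boundary point of the image nearest to
`f z`, Schwarz' lemma is applied to `1 / (h + h z)`, where `h` is a branch of `√(f - w)`: since `f`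
is injective, `h` omits `-u` whenever it attains `u`. -/
theorem norm_deriv_mul_le_bdist_image (hf : DifferentiableOn ℂ f f.source) (hR : 0 < R)
    (hz : ball z R ⊆ f.source) (hne : f '' ball z R ≠ univ) :
    ‖deriv f z‖ * R ≤ 24 * bdist (f '' ball z R) (f z) := by
  set V := f '' ball z R
  have hVo : IsOpen V := f.isOpen_image_of_subset_source isOpen_ball hz
  have hzR : z ∈ ball z R := mem_ball_self hR
  have hzV : f z ∈ V := mem_image_of_mem f hzR
  obtain ⟨w, hw, hdist⟩ : ∃ w ∈ frontier V, bdist V (f z) = dist (f z) w :=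
    isClosed_frontier.exists_infDist_eq_dist (nonempty_frontier_iff.2 ⟨⟨_, hzV⟩, hne⟩) _
  have hwV : w ∉ V := (hVo.frontier_eq ▸ hw).2
  obtain ⟨h, hc, hsq⟩ := exists_continuousOn_sq_eq_sub hR (f.continuousOn.mono hz) hwV
  have hh0 : ∀ ζ ∈ ball z R, h ζ ≠ 0 := fun ζ hζ h0 =>
    hwV ⟨ζ, hζ, sub_eq_zero.1 (by rw [← hsq, h0, zero_pow two_ne_zero])⟩
  have hderiv : ∀ ζ ∈ ball z R, HasDerivAt h (deriv f ζ / (2 * h ζ)) ζ := fun ζ hζ =>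
    hasDerivAt_of_sq_eq ((hf.hasDerivAt (f.open_source.mem_nhds (hz hζ))).sub_const w)
      (hc.continuousAt (isOpen_ball.mem_nhds hζ)) (Eventually.of_forall hsq) (hh0 ζ hζ)
  have hnorm : ‖h z‖ ^ 2 = bdist V (f z) := by rw [← norm_pow, hsq, hdist, dist_eq_norm]
  have hcover : ball (h z) (2 / 5 * ‖h z‖) ⊆ h '' ball z R :=
    ball_subset_image_of_sq_eq_sub hz hR hc hsq (hh0 z hzR) (hnorm ▸ ball_bdist_subset hzV)
  have hschwarz : ‖deriv h z‖ * R ≤ 4 * (1 / (2 / 5) + 1 / 2) * ‖h z‖ :=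
    norm_deriv_mul_le_of_le_norm_add
      (fun ζ hζ => (hderiv ζ hζ).differentiableAt.differentiableWithinAt) hR (hh0 z hzR)
      (by norm_num) fun ζ hζ => le_norm_add_of_sq_eq_sub (f.injOn.mono hz) hsq hh0 hcover hζ
  have hchain : ‖deriv f z‖ = 2 * ‖h z‖ * ‖deriv h z‖ := by
    have := hh0 z hzR
    rw [(hderiv z hzR).deriv, norm_div, norm_mul, Complex.norm_two]
    field_simp
  rw [hchain, ← hnorm]
  nlinarith [norm_nonneg (h z)]

lemma eventually_deriv_ne_zero_of_injOn {g : ℂ → ℂ} {U : Set ℂ} (hU : IsOpen U)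
    (hg : DifferentiableOn ℂ g U) (hinj : InjOn g U) {x : ℂ} (hx : x ∈ U) :
    ∀ᶠ ζ in 𝓝[≠] x, deriv g ζ ≠ 0 := by
  refine (((hg.analyticOnNhd hU).deriv x hx).eventually_eq_zero_or_eventually_ne_zero).resolve_left
    fun h0 => ?_
  obtain ⟨r, hr, hball⟩ := Metric.eventually_nhds_iff_ball.1 (h0.and (hU.mem_nhds hx))
  have hconst : ∀ ζ ∈ ball x r, g ζ = g x := fun ζ hζ =>
    isOpen_ball.is_const_of_deriv_eq_zero (convex_ball x r).isPreconnected
      (hg.mono fun ζ hζ => (hball ζ hζ).2) (fun ζ hζ => (hball ζ hζ).1) hζ (mem_ball_self hr)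
  have hmem : x + (r / 2 : ℝ) ∈ ball x r := by simp [abs_of_pos hr, hr]
  simpa [hr.ne'] using hinj (hball _ hmem).2 hx (hconst _ hmem)

theorem differentiableOn_symm (hf : DifferentiableOn ℂ f f.source) :
    DifferentiableOn ℂ f.symm f.target := by
  intro y hy
  have hx := f.map_target hy
  have hregular := (f.continuousAt_symm hy).eventually (eventually_nhdsWithin_iff.1
    (eventually_deriv_ne_zero_of_injOn f.open_source hf f.injOn hx))
  obtain ⟨ε, hε, hs⟩ := Metric.eventually_nhds_iff_ball.1
    ((f.open_target.eventually_mem hy).and hregular)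
  -- `f.symm` is holomorphic off `y`, and the singularity at `y` is removable by continuity
  refine ((Complex.differentiableOn_compl_singleton_and_continuousAt_iff (ball_mem_nhds y hε)).1
    ⟨fun v hv => ?_, f.continuousAt_symm hy⟩).differentiableAt
      (ball_mem_nhds y hε) |>.differentiableWithinAt
  obtain ⟨hvt, hvd⟩ := hs v hv.1
  exact (f.hasDerivAt_symm hvt (hvd fun he => hv.2 (f.symm.injOn hvt hy he)) (hf.hasDerivAt
    (f.open_source.mem_nhds (f.map_target hvt)))).differentiableAt.differentiableWithinAt

lemma eventually_norm_sub_le_of_hasDerivAt {g : ℂ → ℂ} {g' x : ℂ} {K : ℝ} (hg : HasDerivAt g g' x)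
    (hK : ‖g'‖ < K) : ∀ᶠ y in 𝓝 x, ‖g y - g x‖ ≤ K * ‖y - x‖ := by
  filter_upwards [(hasDerivAt_iff_isLittleO.1 hg).def (sub_pos.2 hK)] with y hy
  calc ‖g y - g x‖ = ‖(g y - g x - (y - x) • g') + (y - x) • g'‖ := by simp
    _ ≤ (K - ‖g'‖) * ‖y - x‖ + ‖y - x‖ * ‖g'‖ :=
      (norm_add_le _ _).trans (add_le_add hy (norm_smul_le _ _))
    _ = K * ‖y - x‖ := by ring

lemma dilatationLE_of_differentiableOn (hf : DifferentiableOn ℂ f f.source)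
    {D : Set ℂ} (hD : IsDom D) (hsub : D ⊆ f.source) (hne : D ≠ univ) (hne' : f '' D ≠ univ) :
    DilatationLE 24 f D (f '' D) := by
  intro x hx K hK
  have hd := bdist_pos hD.1 hne hx
  have hball : ball x (bdist D x) ⊆ D := ball_bdist_subset hx
  have hfball : f '' ball x (bdist D x) ⊆ f '' D := image_mono hball
  have hkoebe := norm_deriv_mul_le_bdist_image hf hd (hball.trans hsub)
    fun h => hne' (univ_subset_iff.1 (h ▸ hfball))
  have hmono : bdist (f '' ball x (bdist D x)) (f x) ≤ bdist (f '' D) (f x) :=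
    le_bdist_of_ball_subset hne' (mem_image_of_mem f hx)
      ((ball_bdist_subset (mem_image_of_mem f (mem_ball_self hd))).trans hfball)
  refine eventually_norm_sub_le_of_hasDerivAt
    (hf.hasDerivAt (f.open_source.mem_nhds (hsub hx))) (hK.trans_le' ?_)
  rw [le_div_iff₀ hd]
  linarith

theorem isFullyQH_of_differentiableOn (hf : DifferentiableOn ℂ f f.source)
    (hne : f.source ≠ univ) (hne' : f.target ≠ univ) : IsFullyQH 24 f := by
  have hproper {g : OpenPartialHomeomorph ℂ ℂ} (hg : g.target ≠ univ) {D : Set ℂ}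
      (hD : D ⊆ g.source) : g '' D ≠ univ := fun h =>
    hg (univ_subset_iff.1 (h ▸ g.image_source_eq_target ▸ image_mono hD))
  exact isFullyQH_of_dilatationLE (by norm_num) hne'
    (fun D hD hs hD' => dilatationLE_of_differentiableOn hf hD hs hD' (hproper hne' hs))
    fun D hD hs hD' => dilatationLE_of_differentiableOn (f := f.symm) (differentiableOn_symm hf)
      hD hs hD' (hproper (g := f.symm) hne hs)

end Univalent

section DistanceRatio

variable {E E' : Type*} [NormedAddCommGroup E] [NormedAddCommGroup E'] {D B : Set E} {x y z : E}

lemma exp_jDist_sub_one (h : 0 < min (bdist D x) (bdist D y)) :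
    Real.exp (jDist D x y) - 1 = ‖x - y‖ / min (bdist D x) (bdist D y) := by
  rw [jDist, Real.exp_log (by positivity), add_sub_cancel_left]

lemma jDist_le_log_one_add_div {R m : ℝ} (hm : 0 < m) (hx : m ≤ bdist D x) (hy : m ≤ bdist D y)
    (hxy : ‖x - y‖ ≤ R) : jDist D x y ≤ Real.log (1 + R / m) := by
  have hmin : m ≤ min (bdist D x) (bdist D y) := le_min hx hy
  have hpos : 0 < min (bdist D x) (bdist D y) := hm.trans_le hmin
  have hR : 0 ≤ R := (norm_nonneg _).trans hxy
  exact Real.log_le_log (by positivity) (by gcongr)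

lemma JIneqOn.exists_jDist_le {f : OpenPartialHomeomorph E E'} {φ : ℝ≥0 ≃ₜ ℝ≥0}
    (h : JIneqOn φ f D) (c : ℝ) :
    ∃ C, ∀ x ∈ D, ∀ y ∈ D, jDist (f '' D) (f x) (f y) ≤ c → jDist D x y ≤ C := by
  obtain ⟨C, hC⟩ := ((isCompact_Icc (a := 0) (b := c.toNNReal)).image φ.continuous).bddAbove
  refine ⟨C, fun x hx y hy hle => (Real.toNNReal_le_iff_le_coe).1 ?_⟩
  refine hC ⟨φ.symm (jDist D x y).toNNReal, ⟨bot_le, ?_⟩, φ.apply_symm_apply _⟩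
  rw [← NNReal.coe_le_coe]
  exact ((h x hx y hy).1.trans hle).trans (Real.le_coe_toNNReal c)

variable [NormedSpace ℝ E]

lemma ball_subset_of_mem_segment (hB : Convex ℝ B) {r : ℝ} (hx : ball x r ⊆ B) (hy : ball y r ⊆ B)
    (hz : z ∈ segment ℝ x y) : ball z r ⊆ B := by
  intro w hw
  obtain ⟨a, b, ha, hb, hab, rfl⟩ := hz
  set v := w - (a • x + b • y) with hv
  have hvr : ‖v‖ < r := by rwa [mem_ball, dist_eq_norm] at hw
  have hmem := hB (hx (a := x + v) (by simpa)) (hy (a := y + v) (by simpa)) ha hb hab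
  rwa [smul_add, smul_add, add_add_add_comm, ← add_smul, hab, one_smul, hv, add_sub_cancel] at hmem

lemma qhDist_le_exp_jDist (hD : IsOpen D) (hB : IsOpen B) (hc : Convex ℝ B) (hne : B ≠ univ)
    (hDB : D ⊆ B) (hx : x ∈ D) (hy : y ∈ D) : qhDist B x y ≤ Real.exp (jDist D x y) - 1 := by
  have hneD : D ≠ univ := fun h => hne (univ_subset_iff.1 (h ▸ hDB))
  have hm : 0 < min (bdist D x) (bdist D y) := lt_min (bdist_pos hD hneD hx) (bdist_pos hD hneD hy)
  have hseg := hc.segment_subset (hDB hx) (hDB hy)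
  rw [exp_jDist_sub_one hm]
  refine qhDist_le_of_segment hB hne hm hseg fun z hz =>
    le_bdist_of_ball_subset hne (hseg hz) (ball_subset_of_mem_segment hc ?_ ?_ hz)
  · exact ((ball_subset_ball (min_le_left _ _)).trans (ball_bdist_subset hx)).trans hDB
  · exact ((ball_subset_ball (min_le_right _ _)).trans (ball_bdist_subset hy)).trans hDB

lemma JIneqOn.exists_qhDist_le {f : OpenPartialHomeomorph E E'} {φ : ℝ≥0 ≃ₜ ℝ≥0}
    (h : JIneqOn φ f D) (hD : IsOpen D) (hB : IsOpen B) (hc : Convex ℝ B) (hne : B ≠ univ)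
    (hDB : D ⊆ B) (c : ℝ) :
    ∃ C, ∀ x ∈ D, ∀ y ∈ D, jDist (f '' D) (f x) (f y) ≤ c → qhDist B x y ≤ C := by
  obtain ⟨C, hC⟩ := h.exists_jDist_le c
  refine ⟨Real.exp C - 1, fun x hx y hy hxy => ?_⟩
  refine (qhDist_le_exp_jDist hD hB hc hne hDB hx hy).trans ?_
  gcongr
  exact hC x hx y hy hxy

end DistanceRatio

section SlitDisk

open Complex ComplexConjugate

variable {f : OpenPartialHomeomorph ℂ ℂ} {z : ℂ}

lemma ofReal_notMem_slitDisk {t : ℝ} (ht : t ∈ Ico (0 : ℝ) 1) : (t : ℂ) ∉ slitDisk :=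
  fun h => h.2 ⟨t, ht, rfl⟩

lemma mem_slitDisk_of_im_ne_zero (hz : ‖z‖ < 1) (him : z.im ≠ 0) : z ∈ slitDisk :=
  ⟨by simpa using hz, by rintro ⟨t, -, rfl⟩; simp at him⟩

lemma norm_lt_one_of_mem_slitDisk (hz : z ∈ slitDisk) : ‖z‖ < 1 := mem_ball_zero_iff.1 hz.1

lemma re_neg_of_mem_slitDisk (hz : z ∈ slitDisk) (him : z.im = 0) : z.re < 0 := by
  by_contra! hre
  refine hz.2 ⟨z.re, ⟨hre, ?_⟩, Complex.ext (by simp) (by simp [him])⟩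
  exact (re_le_norm z).trans_lt (norm_lt_one_of_mem_slitDisk hz)

lemma slitDisk_ne_univ : slitDisk ≠ univ :=
  ne_univ_iff_exists_notMem _ |>.2 ⟨_, ofReal_notMem_slitDisk (t := 0) (by simp)⟩

lemma ball_zero_one_ne_univ : ball (0 : ℂ) 1 ≠ univ :=
  ne_univ_iff_exists_notMem _ |>.2 ⟨1, by simp⟩

lemma isDom_ball : IsDom (ball (0 : ℂ) 1) :=
  ⟨isOpen_ball, (convex_ball 0 1).isConnected ⟨0, by simp⟩⟩

lemma IsSlitMap.isDom_slitDisk (hf : IsSlitMap f) : IsDom slitDisk := by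
  rw [← hf.2.1, ← f.image_source_eq_target]
  exact isDom_image (hf.1 ▸ isDom_ball) subset_rfl

lemma IsSlitMap.isFullyQH (hf : IsSlitMap f) : IsFullyQH 24 f :=
  isFullyQH_of_differentiableOn hf.2.2 (hf.1 ▸ ball_zero_one_ne_univ) (hf.2.1 ▸ slitDisk_ne_univ)

lemma IsSlitMap.isQH (hf : IsSlitMap f) : IsQH 24 f :=
  hf.isFullyQH.isQH (by norm_num) (hf.1 ▸ isDom_ball) (hf.1 ▸ ball_zero_one_ne_univ)

lemma log_le_qhDist_conj_slitDisk (hdom : IsDom slitDisk) (hz : z ∈ slitDisk) (hre : 0 ≤ z.re)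
    (him : 0 < z.im) : Real.log (1 + z.re / z.im) ≤ qhDist slitDisk z (conj z) := by
  have hz' : conj z ∈ slitDisk := mem_slitDisk_of_im_ne_zero
    ((norm_conj z).trans_lt (norm_lt_one_of_mem_slitDisk hz)) (by simpa using him.ne')
  refine le_qhDist hdom hz hz' fun L γ hγ => ?_
  -- a path from `z` to its conjugate crosses the real axis, hence the negative half axis
  obtain ⟨t, ht, hreal⟩ : ∃ t ∈ Icc 0 L, (γ t).im = 0 := by
    refine intermediate_value_Icc' hγ.1 (continuous_im.comp_continuousOn hγ.continuousOn) ⟨?_, ?_⟩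
    · simpa [hγ.2.2.2.2] using him.le
    · simpa [hγ.2.2.2.1] using him.le
  have hfar : z.re ≤ dist z (γ t) := by
    have hneg := re_neg_of_mem_slitDisk (hγ.2.2.1 t ht) hreal
    have hle := re_le_norm (z - γ t)
    rw [sub_re] at hle
    rw [dist_eq_norm]
    linarith
  have hnear : bdist slitDisk z ≤ z.im := by
    have hslit : (z.re : ℂ) ∉ slitDisk := ofReal_notMem_slitDisk
      ⟨hre, (re_le_norm z).trans_lt (norm_lt_one_of_mem_slitDisk hz)⟩
    refine (bdist_le_dist_of_notMem hz hslit).trans_eq ?_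
    rw [dist_of_re_eq (by simp), ofReal_im, Real.dist_0_eq_abs, abs_of_pos him]
  refine le_trans ?_
    (hγ.log_one_add_div_le_qhLength hdom.1 slitDisk_ne_univ ht hre hfar)
  have hpos := bdist_pos hdom.1 slitDisk_ne_univ hz
  exact Real.log_le_log (by positivity) (by gcongr)

lemma jDist_conj_le_log_three {V : Set ℂ} (hV : {w ∈ slitDisk | w.im ≠ 0} ⊆ V) (hne : V ≠ univ)
    (him : z.im ≠ 0) (hz : |z.im| + ‖z‖ ≤ 1) : jDist V z (conj z) ≤ Real.log 3 := by
  have hpos : 0 < |z.im| := abs_pos.2 him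
  have hbdist : ∀ w : ℂ, |w.im| = |z.im| → ‖w‖ = ‖z‖ → |z.im| ≤ bdist V w := by
    intro w hwim hwnorm
    have hball : ball w |z.im| ⊆ V := fun v hv => by
      rw [mem_ball, dist_eq_norm] at hv
      have hnorm : ‖v‖ < 1 := by linarith [norm_le_norm_add_norm_sub' v w]
      have hvim : v.im ≠ 0 := fun h0 => by
        have := (abs_im_le_norm (v - w)).trans_lt hv
        simp [h0, hwim] at this
      exact hV ⟨mem_slitDisk_of_im_ne_zero hnorm hvim, hvim⟩
    exact le_bdist_of_ball_subset hne (hball (mem_ball_self hpos)) hball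
  refine (jDist_le_log_one_add_div (R := 2 * |z.im|) hpos (hbdist z rfl rfl)
    (hbdist (conj z) (by simp) (norm_conj z)) ?_).trans_eq ?_
  · simp [sub_conj]
  · rw [mul_div_cancel_right₀ _ hpos.ne']
    norm_num

lemma tendsto_log_one_add_div_nhdsGT_zero {c : ℝ} (hc : 0 < c) :
    Tendsto (fun ε => Real.log (1 + c / ε)) (𝓝[>] 0) atTop :=
  Real.tendsto_log_atTop.comp
    (tendsto_atTop_add_const_left _ 1 (tendsto_inv_nhdsGT_zero.const_mul_atTop hc))

/- The points `1/2 ± εi` have `j`-distance at most `log 3` in `f(D)`, while their quasihyperbolic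
distance in the slit disk tends to infinity as `ε → 0`. -/
theorem IsSlitMap.not_jIneqOn (hf : IsSlitMap f) (φ : ℝ≥0 ≃ₜ ℝ≥0) {D : Set ℂ} (hD : IsOpen D)
    (hsub : D ⊆ ball 0 1) (himage : {w ∈ slitDisk | w.im ≠ 0} ⊆ f '' D) : ¬ JIneqOn φ f D := by
  intro hJ
  have hdom := hf.isDom_slitDisk
  have hne : f '' D ≠ univ := fun h => slitDisk_ne_univ <| univ_subset_iff.1 <| by
    rw [← h, ← hf.2.1, ← f.image_source_eq_target, hf.1]
    exact image_mono hsub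
  obtain ⟨C, hC⟩ := hJ.exists_qhDist_le hD isOpen_ball (convex_ball 0 1) ball_zero_one_ne_univ
    hsub (Real.log 3)
  obtain ⟨ε, hlog, hε, hε'⟩ := ((tendsto_log_one_add_div_nhdsGT_zero one_half_pos).eventually
    (eventually_gt_atTop (24 * C)) |>.and (Ioo_mem_nhdsGT (by norm_num : (0 : ℝ) < 1 / 4))).exists
  obtain ⟨a, hre, him⟩ : ∃ a : ℂ, a.re = 1 / 2 ∧ a.im = ε := ⟨⟨_, _⟩, rfl, rfl⟩
  have ha : |a.im| + ‖a‖ ≤ 1 := by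
    have hnorm := norm_le_abs_re_add_abs_im a
    rw [hre, him, abs_of_pos one_half_pos, abs_of_pos hε] at hnorm
    rw [him, abs_of_pos hε]
    linarith
  have ha0 : a.im ≠ 0 := him.trans_ne hε.ne'
  have ha1 : ‖a‖ < 1 := by linarith [abs_pos.2 ha0]
  obtain ⟨x, hx, hxa⟩ := himage ⟨mem_slitDisk_of_im_ne_zero ha1 ha0, ha0⟩
  have hconj : (conj a).im ≠ 0 := by simpa using ha0
  obtain ⟨y, hy, hya⟩ := himage
    ⟨mem_slitDisk_of_im_ne_zero ((norm_conj a).trans_lt ha1) hconj, hconj⟩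
  have hle := (hf.isFullyQH (ball 0 1) isDom_ball hf.1.ge ball_zero_one_ne_univ x (hsub hx) y
    (hsub hy)).1
  rw [← hf.1, f.image_source_eq_target, hf.1, hf.2.1, hxa, hya] at hle
  have hball := hC x hx y hy (by rw [hxa, hya]; exact jDist_conj_le_log_three himage hne ha0 ha)
  have hslit := log_le_qhDist_conj_slitDisk hdom (mem_slitDisk_of_im_ne_zero ha1 ha0)
    (hre.trans_ge one_half_pos.le) (hε.trans_eq him.symm)
  rw [hre, him] at hslit
  linarith

lemma IsSlitMap.not_jIneqOn_ball (hf : IsSlitMap f) (φ : ℝ≥0 ≃ₜ ℝ≥0) :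
    ¬ JIneqOn φ f (ball 0 1) := by
  refine hf.not_jIneqOn φ isOpen_ball subset_rfl ?_
  rw [← hf.1, f.image_source_eq_target, hf.2.1]
  exact sep_subset _ _

lemma IsSlitMap.not_jIneqOn_punctured (hf : IsSlitMap f) (φ : ℝ≥0 ≃ₜ ℝ≥0) :
    ¬ JIneqOn φ f (ball 0 1 \ {f.symm (-1 / 2)}) := by
  refine hf.not_jIneqOn φ (isOpen_ball.sdiff isClosed_singleton) sdiff_subset ?_
  rintro w ⟨hw, him⟩
  rw [← hf.2.1] at hw
  have hhalf : (-1 / 2 : ℂ) ∈ f.target := by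
    rw [hf.2.1]
    refine ⟨by simp; norm_num, ?_⟩
    rintro ⟨t, ht, he⟩
    have := congrArg re he
    norm_num at this
    linarith [ht.1]
  refine ⟨f.symm w, ⟨hf.1 ▸ f.map_target hw, fun h => him ?_⟩, f.right_inv hw⟩
  rw [f.symm.injOn hw hhalf h]
  norm_num

end SlitDisk

section SlitMap

open Complex

lemma exists_openPartialHomeomorph_of_injOn {g : ℂ → ℂ} {U : Set ℂ} (hU : IsDom U)
    (hg : DifferentiableOn ℂ g U) (hinj : InjOn g U) :
    ∃ f : OpenPartialHomeomorph ℂ ℂ, f.source = U ∧ f.target = g '' U ∧ ⇑f = g := by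
  have hopen : ∀ s ⊆ U, IsOpen s → IsOpen (g '' s) := by
    refine ((hg.analyticOnNhd hU.1).is_constant_or_isOpen hU.2.isPreconnected).resolve_left ?_
    rintro ⟨c, hc⟩
    have hsub : U.Subsingleton := fun x hx y hy => hinj hx hy ((hc x hx).trans (hc y hy).symm)
    obtain ⟨x, hx⟩ := hU.2.nonempty
    exact (infinite_of_mem_nhds x (hU.1.mem_nhds hx)) hsub.finite
  have hrestr : IsOpenMap (U.domRestrict g) := by
    intro s hs
    rw [domRestrict_eq, image_comp]
    exact hopen _ (Subtype.coe_image_subset U s) (hU.1.isOpenMap_subtype_val s hs)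
  exact ⟨OpenPartialHomeomorph.ofContinuousOpenRestrict (hinj.toPartialEquiv g U) hg.continuousOn
    hrestr hU.1, rfl, rfl, rfl⟩

/-- The Möbius transformation of the unit disk onto the right half plane. -/
def cayley (w : ℂ) : ℂ := (1 + w) / (1 - w)

/-- The inverse of `cayley`, a Möbius transformation of the right half plane onto the disk. -/
def cayleyInv (q : ℂ) : ℂ := (q - 1) / (q + 1)

variable {q w : ℂ}

lemma one_sub_ne_zero_of_norm_lt_one (hw : ‖w‖ < 1) : 1 - w ≠ 0 := fun h => by
  rw [← sub_eq_zero.1 h, norm_one] at hw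
  exact hw.false

lemma add_one_ne_zero_of_re_pos (hq : 0 < q.re) : q + 1 ≠ 0 := fun h => by
  have hre := congrArg re h
  rw [add_re, one_re, zero_re] at hre
  linarith

lemma cayley_cayleyInv (hq : q + 1 ≠ 0) : cayley (cayleyInv q) = q := by
  have hne : q + 1 - (q - 1) ≠ 0 := by ring_nf; norm_num
  rw [cayley, cayleyInv]
  field_simp
  ring

lemma cayleyInv_cayley (hw : 1 - w ≠ 0) : cayleyInv (cayley w) = w := by
  have hne : 1 + w + (1 - w) ≠ 0 := by ring_nf; norm_num
  rw [cayley, cayleyInv]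
  field_simp
  ring

lemma cayley_re_pos (hw : ‖w‖ < 1) : 0 < (cayley w).re := by
  have hre : (cayley w).re = (1 - normSq w) / normSq (1 - w) := by
    rw [cayley, div_re, ← add_div, normSq_apply w]
    simp only [add_re, sub_re, one_re, add_im, sub_im, one_im]
    ring
  have hsq : normSq w < 1 := by
    rw [normSq_eq_norm_sq]
    exact pow_lt_one₀ (norm_nonneg w) hw two_ne_zero
  rw [hre]
  exact div_pos (sub_pos.2 hsq) (normSq_pos.2 (one_sub_ne_zero_of_norm_lt_one hw))

lemma cayley_im_pos (hw : ‖w‖ < 1) (him : 0 < w.im) : 0 < (cayley w).im := by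
  have h : (cayley w).im = 2 * w.im / normSq (1 - w) := by
    rw [cayley, div_im, ← sub_div]
    simp only [add_re, sub_re, one_re, add_im, sub_im, one_im]
    ring
  rw [h]
  exact div_pos (by positivity) (normSq_pos.2 (one_sub_ne_zero_of_norm_lt_one hw))

lemma norm_cayleyInv_lt_one (hq : 0 < q.re) : ‖cayleyInv q‖ < 1 := by
  rw [cayleyInv, norm_div, div_lt_one (norm_pos_iff.2 (add_one_ne_zero_of_re_pos hq)),
    ← sq_lt_sq₀ (norm_nonneg _) (norm_nonneg _), ← normSq_eq_norm_sq, ← normSq_eq_norm_sq,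
    normSq_apply, normSq_apply]
  simp only [add_re, sub_re, one_re, add_im, sub_im, one_im]
  linarith

lemma cayleyInv_im_pos (hre : 0 < q.re) (him : 0 < q.im) : 0 < (cayleyInv q).im := by
  have h : (cayleyInv q).im = 2 * q.im / normSq (q + 1) := by
    rw [cayleyInv, div_im, ← sub_div]
    simp only [add_re, sub_re, one_re, add_im, sub_im, one_im]
    ring
  rw [h]
  exact div_pos (by positivity) (normSq_pos.2 (add_one_ne_zero_of_re_pos hre))

lemma bijOn_cayley : BijOn cayley (ball 0 1) {q | 0 < q.re} := by
  refine InvOn.bijOn (f' := cayleyInv) ⟨fun w hw => ?_, fun q hq => ?_⟩ (fun w hw => ?_)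
    fun q hq => mem_ball_zero_iff.2 (norm_cayleyInv_lt_one hq)
  · exact cayleyInv_cayley (one_sub_ne_zero_of_norm_lt_one (mem_ball_zero_iff.1 hw))
  · exact cayley_cayleyInv (add_one_ne_zero_of_re_pos hq)
  · exact cayley_re_pos (mem_ball_zero_iff.1 hw)

lemma bijOn_I_mul : BijOn (fun q : ℂ => I * q) {q | 0 < q.re} {v | 0 < v.im} := by
  refine InvOn.bijOn (f' := fun v => -I * v) ⟨fun q _ => ?_, fun v _ => ?_⟩ (fun q hq => ?_)
    fun v hv => ?_
  · simp [← mul_assoc]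
  · simp [← mul_assoc]
  · simpa using hq
  · simpa using hv

lemma cpow_inv_two_re_pos {v : ℂ} (hv : v.im ≠ 0) : 0 < (v ^ (2⁻¹ : ℂ)).re := by
  rw [cpow_inv_two_re]
  exact Real.sqrt_pos.2 (by linarith [neg_abs_le v.re, abs_re_lt_norm.2 hv])

lemma cpow_inv_two_im_pos {v : ℂ} (hv : 0 < v.im) : 0 < (v ^ (2⁻¹ : ℂ)).im := by
  rw [cpow_inv_two_im_eq_sqrt hv.le]
  exact Real.sqrt_pos.2 (by linarith [le_abs_self v.re, abs_re_lt_norm.2 hv.ne'])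

lemma eq_of_sq_eq_sq_of_im_pos {a b : ℂ} (ha : 0 < a.im) (hb : 0 < b.im) (h : a ^ 2 = b ^ 2) :
    a = b := by
  refine (sq_eq_sq_iff_eq_or_eq_neg.1 h).resolve_right fun hneg => ?_
  have him := congrArg im hneg
  rw [neg_im] at him
  linarith

lemma bijOn_cpow_inv_two :
    BijOn (fun v : ℂ => v ^ (2⁻¹ : ℂ)) {v | 0 < v.im} {q | 0 < q.re ∧ 0 < q.im} := by
  have hsq : ∀ q : ℂ, 0 < q.re ∧ 0 < q.im → 0 < (q ^ 2).im := fun q hq => by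
    rw [sq, mul_im]
    linarith [mul_pos hq.1 hq.2]
  refine InvOn.bijOn (f' := (· ^ 2)) ⟨fun v _ => cpow_ofNat_inv_pow v 2, fun q hq => ?_⟩
    (fun v hv => ⟨cpow_inv_two_re_pos hv.ne', cpow_inv_two_im_pos hv⟩) hsq
  exact eq_of_sq_eq_sq_of_im_pos (cpow_inv_two_im_pos (hsq q hq)) hq.2 (cpow_ofNat_inv_pow _ 2)

lemma bijOn_cayleyInv :
    BijOn cayleyInv {q | 0 < q.re ∧ 0 < q.im} {w | ‖w‖ < 1 ∧ 0 < w.im} := by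
  refine InvOn.bijOn (f' := cayley) ⟨fun q hq => ?_, fun w hw => ?_⟩
    (fun q hq => ⟨norm_cayleyInv_lt_one hq.1, cayleyInv_im_pos hq.1 hq.2⟩)
    fun w hw => ⟨cayley_re_pos hw.1, cayley_im_pos hw.1 hw.2⟩
  · exact cayley_cayleyInv (add_one_ne_zero_of_re_pos hq.1)
  · exact cayleyInv_cayley (one_sub_ne_zero_of_norm_lt_one hw.1)

lemma exists_sq_eq_of_mem_slitDisk {u : ℂ} (hu : u ∈ slitDisk) :
    ∃ w : ℂ, w ^ 2 = u ∧ 0 < w.im := by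
  obtain ⟨w, rfl⟩ := IsAlgClosed.exists_pow_nat_eq u two_pos
  rcases lt_trichotomy w.im 0 with him | him | him
  · exact ⟨-w, neg_sq w, by rwa [neg_im, neg_pos]⟩
  · have hre := re_neg_of_mem_slitDisk hu (by rw [sq, mul_im, him]; ring)
    rw [sq, mul_re, him, mul_zero, sub_zero] at hre
    exact absurd hre (mul_self_nonneg _).not_gt
  · exact ⟨w, rfl, him⟩

lemma bijOn_sq_halfDisk : BijOn (fun w : ℂ => w ^ 2) {w | ‖w‖ < 1 ∧ 0 < w.im} slitDisk := by
  refine ⟨fun w hw => ⟨?_, ?_⟩, fun a ha b hb => eq_of_sq_eq_sq_of_im_pos ha.2 hb.2, fun u hu => ?_⟩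
  · rw [mem_ball_zero_iff, norm_pow]
    exact pow_lt_one₀ (norm_nonneg w) hw.1 two_ne_zero
  · rintro ⟨t, ht, htw : (t : ℂ) = w ^ 2⟩
    rw [← Real.sq_sqrt ht.1, ofReal_pow] at htw
    have him := hw.2
    rcases sq_eq_sq_iff_eq_or_eq_neg.1 htw.symm with rfl | rfl <;> simp at him
  · obtain ⟨w, rfl, him⟩ := exists_sq_eq_of_mem_slitDisk hu
    have hnorm := norm_lt_one_of_mem_slitDisk hu
    rw [norm_pow] at hnorm
    exact ⟨w, ⟨(pow_lt_one_iff_of_nonneg (norm_nonneg w) two_ne_zero).1 hnorm, him⟩, rfl⟩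

/-- A conformal map of the unit disk onto the slit disk: the disk is mapped successively onto the
right half plane, the upper half plane, the first quadrant, the upper half disk and the slit
disk. -/
def slitMap (z : ℂ) : ℂ := cayleyInv ((I * cayley z) ^ (2⁻¹ : ℂ)) ^ 2

lemma bijOn_slitMap : BijOn slitMap (ball 0 1) slitDisk :=
  bijOn_sq_halfDisk.comp <| bijOn_cayleyInv.comp <| bijOn_cpow_inv_two.comp <|
    bijOn_I_mul.comp bijOn_cayley

lemma differentiableOn_slitMap : DifferentiableOn ℂ slitMap (ball 0 1) := by
  intro z hz
  have hcayley : DifferentiableAt ℂ cayley z := DifferentiableAt.div (by fun_prop) (by fun_prop)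
    (one_sub_ne_zero_of_norm_lt_one (mem_ball_zero_iff.1 hz))
  have him : 0 < (I * cayley z).im := bijOn_I_mul.mapsTo (bijOn_cayley.mapsTo hz)
  have hsqrt : DifferentiableAt ℂ (fun z => (I * cayley z) ^ (2⁻¹ : ℂ)) z :=
    (hcayley.const_mul I).cpow_const (Or.inr him.ne')
  have hdisk : DifferentiableAt ℂ (fun z => cayleyInv ((I * cayley z) ^ (2⁻¹ : ℂ))) z :=
    (hsqrt.sub_const 1).div (hsqrt.add_const 1)
      (add_one_ne_zero_of_re_pos (cpow_inv_two_re_pos him.ne'))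
  exact (hdisk.pow 2).differentiableWithinAt

lemma exists_isSlitMap : ∃ f : OpenPartialHomeomorph ℂ ℂ, IsSlitMap f := by
  obtain ⟨f, hsource, htarget, hcoe⟩ := exists_openPartialHomeomorph_of_injOn isDom_ball
    differentiableOn_slitMap bijOn_slitMap.injOn
  refine ⟨f, hsource, htarget.trans bijOn_slitMap.image_eq, ?_⟩
  rw [hsource, hcoe]
  exact differentiableOn_slitMap

end SlitMap

section LocallyBilipschitz

open AffineMap

variable {E E' : Type*} [NormedAddCommGroup E] [NormedAddCommGroup E']
variable {f : OpenPartialHomeomorph E E'} {M : ℝ}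

lemma IsLocBilip.symm (hM : 0 < M) (hf : IsLocBilip M f) : IsLocBilip M f.symm := by
  intro y hy
  obtain ⟨U, hU, hsub, h⟩ := hf (f.symm y) (f.map_target hy)
  refine ⟨f '' U, ?_, ?_, ?_⟩
  · simpa only [f.right_inv hy] using f.image_mem_nhds (f.map_target hy) hU
  · rintro _ ⟨u, hu, rfl⟩
    exact f.map_source (hsub hu)
  · rintro _ ⟨u, hu, rfl⟩ _ ⟨v, hv, rfl⟩
    rw [f.left_inv (hsub hu), f.left_inv (hsub hv)]
    obtain ⟨hlower, hupper⟩ := h u hu v hv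
    exact ⟨(div_le_iff₀' hM).2 hupper, (div_le_iff₀' hM).1 hlower⟩

lemma exists_lineMap_notMem_forall_lt_mem [NormedSpace ℝ E] {V : Set E} (hV : IsOpen V) {x y : E}
    (hx : x ∈ V) (hy : y ∉ V) :
    ∃ τ ∈ Ioc (0 : ℝ) 1, lineMap x y τ ∉ V ∧ ∀ s ∈ Ico 0 τ, lineMap x y s ∈ V := by
  have hcompact : IsCompact (Icc (0 : ℝ) 1 ∩ lineMap x y ⁻¹' Vᶜ) :=
    isCompact_Icc.inter_right (hV.isClosed_compl.preimage lineMap_continuous)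
  obtain ⟨τ, ⟨hτ, hτV⟩, hmin⟩ := hcompact.exists_isLeast
    ⟨1, right_mem_Icc.2 zero_le_one, by simpa using hy⟩
  refine ⟨τ, ⟨hτ.1.lt_of_ne ?_, hτ.2⟩, hτV, fun s hs => ?_⟩
  · rintro rfl
    exact hτV (by simpa using hx)
  · by_contra hsV
    exact hs.2.not_ge (hmin ⟨⟨hs.1, hs.2.le.trans hτ.2⟩, hsV⟩)

lemma exists_tendsto_nhdsLT [CompleteSpace E] {p : ℝ → E} {K : ℝ≥0} {a b : ℝ} (hab : a < b)
    (hp : LipschitzOnWith K p (Ico a b)) : ∃ q, Tendsto p (𝓝[<] b) (𝓝 q) :=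
  cauchy_map_iff_exists_tendsto.1 <| (cauchy_nhds.mono nhdsWithin_le_nhds).map_of_le
    hp.uniformContinuousOn (le_principal_iff.2 (Ico_mem_nhdsLT hab))

lemma IsLocBilip.norm_sub_le_of_segment_subset [NormedSpace ℝ E] (hf : IsLocBilip M f) {x y : E}
    (hseg : segment ℝ x y ⊆ f.source) : ‖f y - f x‖ ≤ M * ‖y - x‖ := by
  set p : ℝ →ᵃ[ℝ] E := lineMap x y
  have hp : Continuous p := lineMap_continuous
  have hmem : MapsTo p (Icc 0 1) f.source := fun t ht => hseg <| by
    rw [segment_eq_image_lineMap]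
    exact mem_image_of_mem _ ht
  have hcont : ContinuousOn (fun t => ‖f (p t) - f x‖) (Icc 0 1) :=
    ((f.continuousOn.comp hp.continuousOn hmem).sub continuousOn_const).norm
  have h := sub_le_integral_of_eventually_sub_le zero_le_one hcont
    (continuousOn_const (c := M * ‖y - x‖)) fun t ht r hr => ?_
  · simpa [p] using h
  obtain ⟨U, hU, -, hlip⟩ := hf (p t) (hmem (Ico_subset_Icc_self ht))
  filter_upwards [hp.continuousAt.continuousWithinAt hU, self_mem_nhdsWithin] with s hs hts
  have hpos : 0 < s - t := sub_pos.2 hts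
  calc ‖f (p s) - f x‖ - ‖f (p t) - f x‖
      ≤ ‖f (p s) - f (p t)‖ := by simpa using norm_sub_norm_le (f (p s) - f x) (f (p t) - f x)
    _ ≤ M * ‖p s - p t‖ := (hlip _ hs _ (mem_of_mem_nhds hU)).2
    _ = M * ‖y - x‖ * (s - t) := by
        rw [← dist_eq_norm, dist_lineMap_lineMap, dist_comm x, dist_eq_norm y, Real.dist_eq,
          abs_of_pos hpos]
        ring
    _ ≤ r * (s - t) := by gcongr

lemma IsLocBilip.lipschitzOnWith_symm_lineMap [NormedSpace ℝ E'] (hM : 0 < M) (hf : IsLocBilip M f)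
    {x y : E'} {I : Set ℝ} (hI : Convex ℝ I) (hmem : ∀ s ∈ I, lineMap x y s ∈ f.target) :
    LipschitzOnWith (M * ‖y - x‖).toNNReal (fun s => f.symm (lineMap x y s)) I := by
  refine LipschitzOnWith.of_dist_le_mul fun s hs t ht => ?_
  have hseg : segment ℝ (lineMap x y t) (lineMap x y s) ⊆ f.symm.source := by
    rw [← image_segment]
    exact image_subset_iff.2 fun u hu => hmem u (hI.segment_subset ht hs hu)
  rw [Real.coe_toNNReal _ (by positivity), dist_eq_norm]
  refine ((hf.symm hM).norm_sub_le_of_segment_subset hseg).trans_eq ?_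
  rw [← dist_eq_norm, dist_lineMap_lineMap, dist_comm x, dist_eq_norm y]
  ring

/- The preimage of a segment that starts at `f x` is `M`-Lipschitz as long as it exists, so, by
completeness, it has an endpoint where the segment leaves `f '' ball x R`. -/
theorem IsLocBilip.ball_subset_image_ball [CompleteSpace E] [NormedSpace ℝ E'] (hM : 0 < M)
    (hf : IsLocBilip M f) {x : E} {R : ℝ} (hR : ball x R ⊆ f.source) :
    ball (f x) (R / M) ⊆ f '' ball x R := by
  intro w hw
  by_contra hwV
  rw [mem_ball, dist_eq_norm, lt_div_iff₀' hM] at hw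
  have hx : x ∈ ball x R := mem_ball_self (lt_of_le_of_lt (by positivity) hw)
  obtain ⟨τ, hτ, hexit, hV⟩ := exists_lineMap_notMem_forall_lt_mem
    (f.isOpen_image_of_subset_source isOpen_ball hR) (mem_image_of_mem f hx) hwV
  have htarget : ∀ s ∈ Ico 0 τ, lineMap (f x) w s ∈ f.target := fun s hs =>
    image_subset_iff.2 (fun u hu => f.map_source (hR hu)) (hV s hs)
  have hlip := hf.lipschitzOnWith_symm_lineMap hM (convex_Ico 0 τ) htarget
  obtain ⟨q, hq⟩ := exists_tendsto_nhdsLT hτ.1 hlip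
  have hIco : ∀ᶠ s in 𝓝[<] τ, s ∈ Ico 0 τ := Ico_mem_nhdsLT hτ.1
  have hqball : q ∈ ball x R := by
    refine (le_of_tendsto (hq.dist tendsto_const_nhds) (hIco.mono fun s hs => ?_)).trans_lt hw
    have hdist := hlip.dist_le_mul s hs 0 ⟨le_rfl, hτ.1⟩
    rw [lineMap_apply_zero, f.left_inv (hR hx), Real.coe_toNNReal _ (by positivity),
      Real.dist_eq, sub_zero, abs_of_nonneg hs.1] at hdist
    exact hdist.trans (mul_le_of_le_one_right (by positivity) (hs.2.le.trans hτ.2))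
  have hfq : Tendsto (fun s => lineMap (f x) w s) (𝓝[<] τ) (𝓝 (f q)) :=
    ((f.continuousAt (hR hqball)).tendsto.comp hq).congr' <|
      hIco.mono fun s hs => f.right_inv (htarget s hs)
  have hline : Tendsto (fun s => lineMap (f x) w s) (𝓝[<] τ) (𝓝 (lineMap (f x) w τ)) :=
    lineMap_continuous.continuousWithinAt
  exact hexit (tendsto_nhds_unique hfq hline ▸ mem_image_of_mem f hqball)

variable {D : Set E}

lemma IsLocBilip.bdist_div_le_bdist_image [NormedSpace ℝ E] [CompleteSpace E] [NormedSpace ℝ E']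
    (hM : 0 < M) (hf : IsLocBilip M f) (hsub : D ⊆ f.source) (hne : f '' D ≠ univ) {x : E}
    (hx : x ∈ D) : bdist D x / M ≤ bdist (f '' D) (f x) := by
  have hball := ball_bdist_subset hx
  exact le_bdist_of_ball_subset hne (mem_image_of_mem f hx)
    ((hf.ball_subset_image_ball hM (hball.trans hsub)).trans (image_mono hball))

lemma IsLocBilip.dilatationLE [NormedSpace ℝ E] [CompleteSpace E] [NormedSpace ℝ E'] (hM : 0 < M)
    (hf : IsLocBilip M f) (hD : IsOpen D) (hsub : D ⊆ f.source) (hne : D ≠ univ)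
    (hne' : f '' D ≠ univ) : DilatationLE (M ^ 2) f D (f '' D) := by
  intro x hx K hK
  have hle : M ≤ M ^ 2 * bdist (f '' D) (f x) / bdist D x := by
    have hbdist := hf.bdist_div_le_bdist_image hM hsub hne' hx
    rw [div_le_iff₀' hM] at hbdist
    rw [le_div_iff₀ (bdist_pos hD hne hx), sq, mul_assoc]
    gcongr
  obtain ⟨U, hU, -, hlip⟩ := hf x (hsub hx)
  filter_upwards [hU] with y hy
  refine (hlip y hy x (mem_of_mem_nhds hU)).2.trans ?_
  gcongr
  exact hle.trans hK.le

theorem IsLocBilip.isFullyQH [NormedSpace ℝ E] [CompleteSpace E] [NormedSpace ℝ E']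
    [CompleteSpace E'] (hM : 0 < M) (hf : IsLocBilip M f) (hne : f.source ≠ univ)
    (hne' : f.target ≠ univ) : IsFullyQH (M ^ 2) f := by
  refine isFullyQH_of_dilatationLE (pow_pos hM 2) hne' (fun D hD hsub hneD => ?_)
    fun D hD hsub hneD => ?_
  · refine hf.dilatationLE hM hD.1 hsub hneD fun h => hne' (univ_subset_iff.1 ?_)
    rw [← h, ← f.image_source_eq_target]
    exact image_mono hsub
  · refine (hf.symm hM).dilatationLE hM hD.1 hsub hneD fun h => hne (univ_subset_iff.1 ?_)
    rw [← h, ← f.symm_image_target_eq_source]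
    exact image_mono hsub

end LocallyBilipschitz

section Tube

open scoped RealInnerProductSpace

variable {H : Type*} [NormedAddCommGroup H] [InnerProductSpace ℝ H] (e : HilbertBasis ℤ ℝ H)
variable {r : ℝ}

lemma norm_basis (j : ℤ) : ‖e j‖ = 1 := e.orthonormal.1 j

lemma inner_basis (i j : ℤ) : ⟪e i, e j⟫ = if i = j then 1 else 0 :=
  orthonormal_iff_ite.1 e.orthonormal i j

lemma mem_tube_iff_exists {x : H} : x ∈ tube e r ↔ ∃ t : ℝ, ‖x - t • e 1‖ < r := by
  constructor
  · rintro ⟨_, ⟨t, rfl⟩, y, hy, rfl⟩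
    exact ⟨t, by simpa using hy⟩
  · rintro ⟨t, ht⟩
    exact ⟨_, ⟨t, rfl⟩, x - t • e 1, mem_ball_zero_iff.2 ht, add_sub_cancel _ _⟩

lemma mem_tube_iff {x : H} : x ∈ tube e r ↔ ‖x - ⟪e 1, x⟫ • e 1‖ < r := by
  rw [mem_tube_iff_exists]
  refine ⟨fun ⟨t, ht⟩ => lt_of_le_of_lt ?_ ht, fun h => ⟨_, h⟩⟩
  set s := ⟪e 1, x⟫
  have horth : ⟪x - s • e 1, (s - t) • e 1⟫ = 0 := by
    rw [inner_smul_right, inner_sub_left, real_inner_smul_left, inner_basis, if_pos rfl,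
      real_inner_comm, mul_one, sub_self, mul_zero]
  have hpyth := norm_add_sq_eq_norm_sq_add_norm_sq_of_inner_eq_zero _ _ horth
  rw [sub_smul, sub_add_sub_cancel] at hpyth
  nlinarith [norm_nonneg (x - t • e 1), norm_nonneg (x - s • e 1), norm_nonneg (s • e 1 - t • e 1)]

lemma ball_subset_tube (r t : ℝ) : ball (t • e 1) r ⊆ tube e r := fun _ hx =>
  (mem_tube_iff_exists e).2 ⟨t, mem_ball_iff_norm.1 hx⟩

lemma smul_mem_tube (hr : 0 < r) (t : ℝ) : t • e 1 ∈ tube e r :=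
  ball_subset_tube e r t (mem_ball_self hr)

lemma smul_two_notMem_tube (hr : 0 < r) : r • e 2 ∉ tube e r := by
  rw [mem_tube_iff, inner_smul_right, inner_basis]
  simp [norm_smul, norm_basis, abs_of_pos hr]

lemma tube_ne_univ (hr : 0 < r) : tube e r ≠ univ := fun h =>
  smul_two_notMem_tube e hr (h ▸ mem_univ _)

lemma isDom_tube (hr : 0 < r) : IsDom (tube e r) := by
  have haxis : axis e = LinearMap.range (LinearMap.toSpanSingleton ℝ H (e 1)) := by
    ext x
    simp [axis]
  have hconvex : Convex ℝ (tube e r) :=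
    (haxis ▸ Submodule.convex _ : Convex ℝ (axis e)).add (convex_ball 0 r)
  exact ⟨isOpen_ball.add_left, hconvex.isConnected ⟨_, smul_mem_tube e hr 0⟩⟩

lemma log_one_add_div_le_jDist_tube (hr : 0 < r) {t : ℝ} (ht : 0 ≤ t) :
    Real.log (1 + t / r) ≤ jDist (tube e r) ((0 : ℝ) • e 1) (t • e 1) := by
  have hpos (s : ℝ) : 0 < bdist (tube e r) (s • e 1) :=
    bdist_pos (isDom_tube e hr).1 (tube_ne_univ e hr) (smul_mem_tube e hr s)
  have hle : bdist (tube e r) ((0 : ℝ) • e 1) ≤ r := by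
    refine (bdist_le_dist_of_notMem (smul_mem_tube e hr 0) (smul_two_notMem_tube e hr)).trans_eq ?_
    rw [zero_smul, dist_zero_left, norm_smul, norm_basis, mul_one, Real.norm_of_nonneg hr.le]
  have hmin := lt_min (hpos 0) (hpos t)
  rw [jDist, ← sub_smul, zero_sub, neg_smul, norm_neg, norm_smul, norm_basis, mul_one,
    Real.norm_of_nonneg ht]
  refine Real.log_le_log (by positivity) ?_
  gcongr
  exact (min_le_left _ _).trans hle

lemma ne_univ_of_isBounded (e : HilbertBasis ℤ ℝ H) {S : Set H} (hS : Bornology.IsBounded S) :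
    S ≠ univ := by
  rintro rfl
  have : Nontrivial H := ⟨⟨e 0, 0, e.orthonormal.ne_zero 0⟩⟩
  exact NormedSpace.unbounded_univ ℝ H hS

/- The distance to the boundary of the image is bounded below along the axis, so `j` stays bounded
on the image of the axis, while it is unbounded on the axis itself. -/
theorem IsLocBilip.not_jIneqOn_tube [CompleteSpace H] {M : ℝ} {f : OpenPartialHomeomorph H H}
    (hM : 0 < M) (hf : IsLocBilip M f) (hr : 0 < r) (hsource : f.source = tube e r)
    (hbdd : Bornology.IsBounded f.target) (φ : ℝ≥0 ≃ₜ ℝ≥0) : ¬ JIneqOn φ f (tube e r) := by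
  intro hJ
  obtain ⟨B, hB⟩ := isBounded_iff.1 hbdd
  obtain ⟨C, hC⟩ := hJ.exists_jDist_le (Real.log (1 + B / (r / M)))
  have hne : f '' tube e r ≠ univ := by
    rw [← hsource, f.image_source_eq_target]
    exact ne_univ_of_isBounded e hbdd
  have hmem (t : ℝ) : f (t • e 1) ∈ f.target := f.map_source (hsource ▸ smul_mem_tube e hr t)
  have hbdist (t : ℝ) : r / M ≤ bdist (f '' tube e r) (f (t • e 1)) := by
    refine le_trans ?_ (hf.bdist_div_le_bdist_image hM hsource.ge hne (smul_mem_tube e hr t))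
    gcongr
    exact le_bdist_of_ball_subset (tube_ne_univ e hr) (smul_mem_tube e hr t)
      (ball_subset_tube e r t)
  have hlog (t : ℝ) (ht : 0 ≤ t) : Real.log (1 + t / r) ≤ C :=
    (log_one_add_div_le_jDist_tube e hr ht).trans <|
      hC _ (smul_mem_tube e hr 0) _ (smul_mem_tube e hr t) <|
        jDist_le_log_one_add_div (by positivity) (hbdist 0) (hbdist t) <|
          dist_eq_norm (f _) (f _) ▸ hB (hmem 0) (hmem t)
  have hexp := hlog (r * Real.exp C) (by positivity)
  rw [mul_div_cancel_left₀ _ hr.ne', Real.log_le_iff_le_exp (by positivity)] at hexp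
  linarith

end Tube

section Interpolation

variable {V : Type*}

/-- The piecewise affine interpolation of a two-sided sequence. -/
def interp [AddCommGroup V] [Module ℝ V] (h : ℤ → V) (t : ℝ) : V :=
  (1 - Int.fract t) • h ⌊t⌋ + Int.fract t • h (⌊t⌋ + 1)

section Module

variable [AddCommGroup V] [Module ℝ V]

lemma interp_eq (h : ℤ → V) {n : ℤ} {t : ℝ} (ht : t ∈ Icc (n : ℝ) (n + 1)) :
    interp h t = (1 - (t - n)) • h n + (t - n) • h (n + 1) := by
  rcases ht.2.lt_or_eq with hlt | rfl
  · rw [interp, Int.fract, Int.floor_eq_iff.2 ⟨ht.1, hlt⟩]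
  · simp [interp]

lemma interp_sub_interp (h : ℤ → V) {n : ℤ} {s t : ℝ} (hs : s ∈ Icc (n : ℝ) (n + 1))
    (ht : t ∈ Icc (n : ℝ) (n + 1)) :
    interp h t - interp h s = (t - s) • (h (n + 1) - h n) := by
  rw [interp_eq h hs, interp_eq h ht]
  module

lemma exists_interp_eq (t : ℝ) : ∃ (n : ℤ) (θ : ℝ), θ ∈ Icc (0 : ℝ) 1 ∧
    ∀ h : ℤ → V, interp h t = (1 - θ) • h n + θ • h (n + 1) :=
  ⟨⌊t⌋, Int.fract t, ⟨Int.fract_nonneg t, (Int.fract_lt_one t).le⟩, fun _ => rfl⟩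

lemma interp_sub (h k : ℤ → V) (t : ℝ) :
    interp (fun n => h n - k n) t = interp h t - interp k t := by
  simp only [interp]
  module

lemma range_interp (h : ℤ → V) : range (interp h) = ⋃ j : ℤ, segment ℝ (h (j - 1)) (h j) := by
  ext y
  simp only [mem_range, mem_iUnion, segment_eq_image, mem_image]
  constructor
  · rintro ⟨t, rfl⟩
    obtain ⟨n, θ, hθ, heq⟩ := exists_interp_eq (V := V) t
    exact ⟨n + 1, θ, hθ, by rw [heq, add_sub_cancel_right]⟩
  · rintro ⟨j, θ, hθ, rfl⟩
    refine ⟨(j - 1 : ℤ) + θ, ?_⟩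
    rw [interp_eq h ⟨le_add_of_nonneg_right hθ.1, by gcongr; exact hθ.2⟩, add_sub_cancel_left,
      sub_add_cancel]

end Module

section Norm

variable [NormedAddCommGroup V] [NormedSpace ℝ V] {h : ℤ → V} {C : ℝ}

lemma norm_interp_le (hC : ∀ n, ‖h n‖ ≤ C) (t : ℝ) : ‖interp h t‖ ≤ C := by
  have hmem (n : ℤ) : h n ∈ closedBall 0 C := mem_closedBall_zero_iff.2 (hC n)
  exact mem_closedBall_zero_iff.1 <| convex_closedBall 0 C (hmem _) (hmem _)
    (sub_nonneg.2 (Int.fract_lt_one t).le) (Int.fract_nonneg t) (sub_add_cancel _ _)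

lemma norm_interp_sub_le (hC : ∀ n, ‖h (n + 1) - h n‖ ≤ C) (s t : ℝ) :
    ‖interp h t - interp h s‖ ≤ C * |t - s| := by
  wlog hle : s ≤ t generalizing s t
  · rw [norm_sub_rev, abs_sub_comm]
    exact this t s (le_of_not_ge hle)
  rw [abs_of_nonneg (sub_nonneg.2 hle)]
  have hcell (n : ℤ) {a b : ℝ} (ha : n ≤ a) (hab : a ≤ b) (hb : b ≤ n + 1) :
      ‖interp h b - interp h a‖ ≤ C * (b - a) := by
    rw [interp_sub_interp h ⟨ha, hab.trans hb⟩ ⟨ha.trans hab, hb⟩, norm_smul,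
      Real.norm_of_nonneg (sub_nonneg.2 hab), mul_comm]
    exact mul_le_mul_of_nonneg_right (hC n) (sub_nonneg.2 hab)
  suffices H : ∀ (k : ℕ) (t : ℝ), s ≤ t → t ≤ ⌊s⌋ + 1 + k →
      ‖interp h t - interp h s‖ ≤ C * (t - s) by
    obtain ⟨k, hk⟩ := exists_nat_ge (t - s)
    exact H k t hle (by linarith [Int.lt_floor_add_one s])
  intro k
  induction k with
  | zero => exact fun t hst ht => hcell ⌊s⌋ (Int.floor_le s) hst (by simpa using ht)
  | succ k ih =>
    intro t hst ht
    rcases le_total t (⌊s⌋ + 1 + k) with hk | hk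
    · exact ih t hst hk
    · have hleft := ih (⌊s⌋ + 1 + k) (by linarith [Int.lt_floor_add_one s, k.cast_nonneg (α := ℝ)])
        le_rfl
      have hright := hcell (⌊s⌋ + 1 + k) (by push_cast; rfl) hk (by push_cast at ht ⊢; linarith)
      linarith [norm_sub_le_norm_sub_add_norm_sub (interp h t) (interp h (⌊s⌋ + 1 + k))
        (interp h s)]

lemma continuous_interp (hC : ∀ n, ‖h (n + 1) - h n‖ ≤ C) : Continuous (interp h) :=
  (LipschitzWith.of_dist_le' fun s t => by
    rw [dist_eq_norm, Real.dist_eq]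
    exact norm_interp_sub_le hC t s).continuous

end Norm

open scoped RealInnerProductSpace in
lemma inner_interp [NormedAddCommGroup V] [InnerProductSpace ℝ V] (x : V) (h : ℤ → V) (t : ℝ) :
    ⟪x, interp h t⟫ = interp (fun n => ⟪x, h n⟫) t := by
  simp only [interp, inner_add_right, inner_smul_right, smul_eq_mul]

end Interpolation

section QuarterTurn

open scoped RealInnerProductSpace

variable {H : Type*} [NormedAddCommGroup H] [InnerProductSpace ℝ H] {a b : H}

/-- The quarter turn that takes `a` to `b` and fixes the orthogonal complement of their plane, for
orthogonal vectors `a`, `b` of the same norm: the reflection exchanging `a` and `b`, followed by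
the one that changes the sign of `a`. -/
def quarterTurn (a b : H) : H ≃ₗᵢ[ℝ] H :=
  (ℝ ∙ (a - b))ᗮ.reflection.trans (ℝ ∙ a)ᗮ.reflection

lemma quarterTurn_left (hnorm : ‖a‖ = ‖b‖) (horth : ⟪a, b⟫ = 0) : quarterTurn a b a = b := by
  rw [quarterTurn, LinearIsometryEquiv.trans_apply, Submodule.reflection_sub hnorm]
  exact Submodule.reflection_mem_subspace_eq_self
    (Submodule.mem_orthogonal_singleton_iff_inner_right.2 horth)

lemma quarterTurn_right (hnorm : ‖a‖ = ‖b‖) : quarterTurn a b b = -a := by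
  have hswap : (ℝ ∙ (a - b))ᗮ.reflection b = a := by
    rw [← Submodule.reflection_symm, LinearIsometryEquiv.symm_apply_eq,
      Submodule.reflection_sub hnorm]
  rw [quarterTurn, LinearIsometryEquiv.trans_apply, hswap,
    Submodule.reflection_orthogonalComplement_singleton_eq_neg]

lemma quarterTurn_apply (ha : a ≠ 0) (hnorm : ‖a‖ = ‖b‖) (horth : ⟪a, b⟫ = 0) (x : H) :
    quarterTurn a b x
      = x - ((⟪a, x⟫ + ⟪b, x⟫) / ‖a‖ ^ 2) • a + ((⟪a, x⟫ - ⟪b, x⟫) / ‖a‖ ^ 2) • b := by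
  have ha' : ‖a‖ ≠ 0 := norm_ne_zero_iff.2 ha
  have hsub : ‖a - b‖ ^ 2 = 2 * ‖a‖ ^ 2 := by
    rw [norm_sub_sq_real, horth, ← hnorm]
    ring
  have hrefl (u v : H) : (ℝ ∙ u)ᗮ.reflection v = v - (2 * (⟪u, v⟫ / ‖u‖ ^ 2)) • u := by
    rw [Submodule.reflection_orthogonal_apply, Submodule.reflection_singleton_apply]
    simp only [RCLike.ofReal_real_eq_id, id]
    module
  rw [quarterTurn, LinearIsometryEquiv.trans_apply, hrefl, hrefl, hsub, inner_sub_right,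
    inner_smul_right, inner_sub_right, horth, inner_sub_left, real_inner_self_eq_norm_sq]
  match_scalars <;> field_simp
  ring

lemma inner_quarterTurn (hnorm : ‖a‖ = ‖b‖) (x : H) : ⟪a, quarterTurn a b x⟫ = -⟪b, x⟫ := by
  rw [← (quarterTurn a b).inner_map_map b x, quarterTurn_right hnorm, inner_neg_left, neg_neg]

lemma inner_self_quarterTurn_nonneg (ha : a ≠ 0) (hnorm : ‖a‖ = ‖b‖) (horth : ⟪a, b⟫ = 0) (x : H) :
    0 ≤ ⟪x, quarterTurn a b x⟫ := by
  have ha' : ‖a‖ ≠ 0 := norm_ne_zero_iff.2 ha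
  have heq : ⟪x, quarterTurn a b x⟫
      = ‖x - (⟪a, x⟫ / ‖a‖ ^ 2) • a - (⟪b, x⟫ / ‖a‖ ^ 2) • b‖ ^ 2 := by
    rw [quarterTurn_apply ha hnorm horth, ← real_inner_self_eq_norm_sq (x - _ - _)]
    simp only [inner_add_right, inner_sub_right, inner_smul_right, inner_sub_left,
      real_inner_smul_left, horth, real_inner_comm a x, real_inner_comm b x, real_inner_comm a b]
    rw [real_inner_self_eq_norm_sq a, real_inner_self_eq_norm_sq b, ← hnorm]
    field_simp
    ring
  exact heq ▸ sq_nonneg _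

/- In the plane of `a` and `b`, both `z` and the image of `b` under the interpolated turn are
orthogonal to the interpolated vector; `μ` is the ratio of the two. -/
lemma exists_interp_quarterTurn_eq (ha : a ≠ 0) (hnorm : ‖a‖ = ‖b‖) (horth : ⟪a, b⟫ = 0) {θ : ℝ}
    {z : H} (hz : (1 - θ) * ⟪a, z⟫ + θ * ⟪b, z⟫ = 0) :
    ∃ w, ⟪a, w⟫ = 0 ∧ (1 - θ) • w + θ • quarterTurn a b w = z := by
  have ha' : ‖a‖ ≠ 0 := norm_ne_zero_iff.2 ha
  have hθ : (1 - θ) ^ 2 + θ ^ 2 ≠ 0 := by nlinarith [sq_nonneg (1 - 2 * θ)]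
  set μ := ((1 - θ) * ⟪b, z⟫ - θ * ⟪a, z⟫) / (((1 - θ) ^ 2 + θ ^ 2) * ‖a‖ ^ 2)
  have haz : ⟪a, z⟫ = -(θ * μ * ‖a‖ ^ 2) := by
    simp only [μ]
    field_simp
    linear_combination (1 - θ) * hz
  have hbz : ⟪b, z⟫ = (1 - θ) * μ * ‖a‖ ^ 2 := by
    simp only [μ]
    field_simp
    linear_combination θ * hz
  refine ⟨z + (θ * μ) • (a + b), ?_, ?_⟩
  · rw [inner_add_right, inner_smul_right, inner_add_right, horth, real_inner_self_eq_norm_sq, haz]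
    ring
  · rw [map_add, map_smul, map_add, quarterTurn_left hnorm horth, quarterTurn_right hnorm,
      quarterTurn_apply ha hnorm horth, haz, hbz]
    match_scalars <;> field_simp <;> ring

end QuarterTurn

section BrokenLine

open scoped RealInnerProductSpace

variable {H : Type*} [NormedAddCommGroup H] [InnerProductSpace ℝ H] (e : HilbertBasis ℤ ℝ H)

lemma norm_basis_sub {i j : ℤ} (hij : i ≠ j) : ‖e i - e j‖ = √2 := by
  rw [eq_comm, Real.sqrt_eq_iff_mul_self_eq zero_le_two (norm_nonneg _), ← pow_two,
    norm_sub_sq_real, norm_basis, norm_basis, inner_basis, if_neg hij]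
  norm_num

lemma norm_basis_sub_le (i j : ℤ) : ‖e i - e j‖ ≤ 2 := by
  linarith [norm_sub_le (e i) (e j), norm_basis e i, norm_basis e j]

/-- The direction of the bisector of the broken line at its vertex `e n`: the two edges at `e n`
make the same angle with it. -/
def cornerDir (n : ℤ) : H := e (n + 1) - e (n - 1)

lemma norm_cornerDir (n : ℤ) : ‖cornerDir e n‖ = √2 := norm_basis_sub e (by omega)

lemma norm_cornerDir_le (n : ℤ) : ‖cornerDir e n‖ ≤ 2 := norm_basis_sub_le e _ _

lemma norm_cornerDir_sub_le (m n : ℤ) : ‖cornerDir e m - cornerDir e n‖ ≤ 4 := by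
  linarith [norm_sub_le (cornerDir e m) (cornerDir e n), norm_cornerDir_le e m,
    norm_cornerDir_le e n]

lemma cornerDir_ne_zero (n : ℤ) : cornerDir e n ≠ 0 := by
  rw [← norm_ne_zero_iff, norm_cornerDir]
  positivity

lemma norm_cornerDir_eq (m n : ℤ) : ‖cornerDir e m‖ = ‖cornerDir e n‖ := by
  rw [norm_cornerDir, norm_cornerDir]

lemma inner_cornerDir_basis (n j : ℤ) :
    ⟪cornerDir e n, e j⟫ = (if n + 1 = j then 1 else 0) - if n - 1 = j then 1 else 0 := by
  rw [cornerDir, inner_sub_left, inner_basis, inner_basis]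

lemma inner_cornerDir_succ (n : ℤ) : ⟪cornerDir e n, cornerDir e (n + 1)⟫ = 0 := by
  rw [cornerDir.eq_def e (n + 1), inner_sub_right, inner_cornerDir_basis, inner_cornerDir_basis]
  simp [show n - 1 ≠ n + 1 + 1 by omega]

variable {e} in
lemma inner_cornerDir_interp {n : ℤ} {s : ℝ} (hs : s ∈ Icc ((n : ℝ) - 1) (n + 1)) :
    ⟪cornerDir e n, interp e s⟫ = s - n := by
  rcases le_total s n with h | h
  · rw [inner_interp, interp_eq (n := n - 1) _ ⟨by push_cast; exact hs.1, by push_cast; linarith⟩,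
      inner_cornerDir_basis, inner_cornerDir_basis]
    split_ifs <;> first | omega | (push_cast [smul_eq_mul]; ring)
  · rw [inner_interp, interp_eq _ ⟨h, hs.2⟩, inner_cornerDir_basis, inner_cornerDir_basis]
    split_ifs <;> first | omega | (rw [smul_eq_mul, smul_eq_mul]; ring)

variable {e} in
lemma inner_cornerDir_interp_of_ge {n : ℤ} {s : ℝ} (hs : s ∈ Icc ((n : ℝ) + 1) (n + 2)) :
    ⟪cornerDir e n, interp e s⟫ = n + 2 - s := by
  rw [inner_interp, interp_eq (n := n + 1) _ (by push_cast; constructor <;> linarith [hs.1, hs.2]),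
    inner_cornerDir_basis, inner_cornerDir_basis]
  split_ifs <;> first | omega | (push_cast [smul_eq_mul]; ring)

variable {e} in
lemma inner_cornerDir_interp_of_le {n : ℤ} {s : ℝ} (hs : s ∈ Icc ((n : ℝ) - 2) (n - 1)) :
    ⟪cornerDir e n, interp e s⟫ = n - 2 - s := by
  rw [inner_interp, interp_eq (n := n - 2) _ (by push_cast; constructor <;> linarith [hs.1, hs.2]),
    inner_cornerDir_basis, inner_cornerDir_basis]
  split_ifs <;> first | omega | (push_cast [smul_eq_mul]; ring)

variable {e} in
/- For fixed `t`, the inner product with the direction interpolated at `t` grows along the broken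
line near `t` with slope at least `1 / 2`. -/
lemma half_sq_sub_le_inner_interp {s t : ℝ} (hst : |t - s| ≤ 1 / 4) :
    (t - s) ^ 2 / 2 ≤ (t - s) * ⟪interp (cornerDir e) t, interp e t - interp e s⟫ := by
  obtain ⟨hst₁, hst₂⟩ := abs_le.1 hst
  set n := ⌊t⌋
  have hn₁ : n ≤ t := Int.floor_le t
  have hn₂ : t ≤ n + 1 := (Int.lt_floor_add_one t).le
  have hcast : ((n + 1 : ℤ) : ℝ) = n + 1 := by push_cast; rfl
  have hleft : ⟪cornerDir e n, interp e t⟫ = t - n :=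
    inner_cornerDir_interp ⟨by linarith, hn₂⟩
  have hright : ⟪cornerDir e (n + 1), interp e t⟫ = t - (n + 1) := by
    rw [inner_cornerDir_interp, hcast]
    constructor <;> linarith
  rw [interp_eq (cornerDir e) ⟨hn₁, hn₂⟩, inner_sub_right]
  simp only [inner_add_left, real_inner_smul_left, hleft, hright]
  rcases le_total s n with hs | hs
  · rw [inner_cornerDir_interp ⟨by linarith, by linarith⟩,
      inner_cornerDir_interp_of_le (by rw [hcast]; constructor <;> linarith), hcast]
    nlinarith [mul_nonneg (sub_nonneg.2 (hs.trans hn₁)) (sub_nonneg.2 hs)]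
  rcases le_total s (n + 1) with hs' | hs'
  · rw [inner_cornerDir_interp ⟨by linarith, hs'⟩,
      inner_cornerDir_interp (by rw [hcast]; constructor <;> linarith), hcast]
    nlinarith [sq_nonneg (t - s)]
  · rw [inner_cornerDir_interp_of_ge ⟨hs', by linarith⟩,
      inner_cornerDir_interp (by rw [hcast]; constructor <;> linarith), hcast]
    nlinarith [mul_nonneg (sub_nonneg.2 (hn₂.trans hs')) (sub_nonneg.2 hs')]

lemma norm_interp_basis_sub_le (s t : ℝ) : ‖interp e t - interp e s‖ ≤ 2 * |t - s| :=
  norm_interp_sub_le (fun _ => norm_basis_sub_le e _ _) s t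

variable {e} in
lemma half_le_norm_interp_sub {s t : ℝ} (hst : ⌊s⌋ + 1 < ⌊t⌋) :
    1 / 2 ≤ ‖interp e t - interp e s‖ := by
  set x := e ⌊t⌋ + e (⌊t⌋ + 1)
  have hx : ‖x‖ ≤ 2 := by
    linarith [norm_add_le (e ⌊t⌋) (e (⌊t⌋ + 1)), norm_basis e ⌊t⌋, norm_basis e (⌊t⌋ + 1)]
  have ht : ⟪x, interp e t⟫ = 1 := by
    simp only [interp, x, inner_add_left, inner_add_right, inner_smul_right, inner_basis]
    split_ifs <;> first | omega | ring
  have hs : ⟪x, interp e s⟫ = 0 := by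
    simp only [interp, x, inner_add_left, inner_add_right, inner_smul_right, inner_basis]
    split_ifs <;> first | omega | ring
  have hcs := real_inner_le_norm x (interp e t - interp e s)
  rw [inner_sub_right, ht, hs] at hcs
  nlinarith [norm_nonneg (interp e t - interp e s)]

variable {e} in
lemma sub_le_two_mul_norm_interp_sub {s t : ℝ} (hst : s ≤ t) (hfloor : ⌊t⌋ ≤ ⌊s⌋ + 1) :
    t - s ≤ 2 * ‖interp e t - interp e s‖ := by
  have hfloor' : (⌊t⌋ : ℝ) ≤ ⌊s⌋ + 1 := by exact_mod_cast hfloor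
  have hs := Int.floor_le s
  have ht := Int.floor_le t
  have ht' := Int.lt_floor_add_one t
  have hcs := real_inner_le_norm (cornerDir e ⌊t⌋) (interp e t - interp e s)
  rw [inner_sub_right, inner_cornerDir_interp ⟨by linarith, ht'.le⟩,
    inner_cornerDir_interp ⟨by linarith, by linarith⟩] at hcs
  nlinarith [norm_cornerDir_le e ⌊t⌋, norm_nonneg (interp e t - interp e s)]

variable {e} in
lemma eighth_le_norm_interp_sub {s t : ℝ} (hst : 1 / 4 ≤ |t - s|) :
    1 / 8 ≤ ‖interp e t - interp e s‖ := by
  wlog hle : s ≤ t generalizing s t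
  · rw [norm_sub_rev]
    exact this (by rwa [abs_sub_comm]) (le_of_not_ge hle)
  rw [abs_of_nonneg (sub_nonneg.2 hle)] at hst
  rcases lt_or_ge (⌊s⌋ + 1) ⌊t⌋ with hfloor | hfloor
  · linarith [half_le_norm_interp_sub (e := e) hfloor]
  · linarith [sub_le_two_mul_norm_interp_sub (e := e) hle hfloor]

end BrokenLine

section Frame

open scoped RealInnerProductSpace

variable {H : Type*} [NormedAddCommGroup H] [InnerProductSpace ℝ H] (e : HilbertBasis ℤ ℝ H)

/-- The frame at the vertex `e n` of the broken line: an isometry that takes `e 1` to the direction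
of `cornerDir e n`. Consecutive frames differ by the quarter turn between these directions. -/
def frame (n : ℤ) : H ≃ₗᵢ[ℝ] H :=
  n.inductionOn' 0 (ℝ ∙ (√2 • e 1 - cornerDir e 0))ᗮ.reflection
    (fun k _ T => T.trans (quarterTurn (cornerDir e k) (cornerDir e (k + 1))))
    (fun k _ T => T.trans (quarterTurn (cornerDir e (k - 1)) (cornerDir e k)).symm)

lemma frame_succ_apply (n : ℤ) (x : H) :
    frame e (n + 1) x = quarterTurn (cornerDir e n) (cornerDir e (n + 1)) (frame e n x) := by
  rcases le_or_gt 0 n with hn | hn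
  · rw [frame, Int.inductionOn'_add_one hn]
    rfl
  · have hpred : frame e n = (frame e (n + 1)).trans
        (quarterTurn (cornerDir e n) (cornerDir e (n + 1))).symm := by
      have := Int.inductionOn'_sub_one (motive := fun _ => H ≃ₗᵢ[ℝ] H) (b := 0) (z := n + 1) hn
        (zero := (ℝ ∙ (√2 • e 1 - cornerDir e 0))ᗮ.reflection)
        (succ := fun k _ T => T.trans (quarterTurn (cornerDir e k) (cornerDir e (k + 1))))
        (pred := fun k _ T => T.trans (quarterTurn (cornerDir e (k - 1)) (cornerDir e k)).symm)
      simpa only [add_sub_cancel_right, frame] using this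
    rw [hpred, LinearIsometryEquiv.trans_apply, LinearIsometryEquiv.apply_symm_apply]

lemma frame_sqrt_two_smul (n : ℤ) : frame e n (√2 • e 1) = cornerDir e n := by
  have hturn (k : ℤ) : quarterTurn (cornerDir e k) (cornerDir e (k + 1)) (cornerDir e k)
      = cornerDir e (k + 1) :=
    quarterTurn_left (norm_cornerDir_eq e _ _) (inner_cornerDir_succ e k)
  induction n using Int.induction_on with
  | zero =>
    rw [frame, Int.inductionOn'_self]
    refine Submodule.reflection_sub ?_
    rw [norm_smul, norm_basis, norm_cornerDir, mul_one, Real.norm_of_nonneg (Real.sqrt_nonneg 2)]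
  | succ n ih => rw [frame_succ_apply, ih, hturn]
  | pred n ih =>
    rw [← sub_add_cancel (-(n : ℤ)) 1, frame_succ_apply, sub_add_cancel] at ih
    have hprev := hturn (-n - 1)
    rw [sub_add_cancel] at hprev
    exact (LinearIsometryEquiv.injective _) (ih.trans hprev.symm)

lemma inner_cornerDir_frame (n : ℤ) (v : H) :
    ⟪cornerDir e n, frame e n v⟫ = √2 * ⟪e 1, v⟫ := by
  rw [← frame_sqrt_two_smul, LinearIsometryEquiv.inner_map_map, real_inner_smul_left]

/-- The linear map that takes the complement of `e 1` onto the hyperplane normal to the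
interpolated direction `interp (cornerDir e) t`, interpolating the frames at the vertices. -/
def frameAt (t : ℝ) (v : H) : H := interp (fun n => frame e n v) t

lemma frameAt_sub (t : ℝ) (v w : H) : frameAt e t (v - w) = frameAt e t v - frameAt e t w := by
  simp only [frameAt, map_sub, interp_sub]

lemma norm_frameAt_le (t : ℝ) (v : H) : ‖frameAt e t v‖ ≤ ‖v‖ :=
  norm_interp_le (fun n => ((frame e n).norm_map v).le) t

lemma norm_frameAt_sub_frameAt_le (s t : ℝ) (v : H) :
    ‖frameAt e t v - frameAt e s v‖ ≤ 2 * ‖v‖ * |t - s| := by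
  refine norm_interp_sub_le (fun n => (norm_sub_le _ _).trans ?_) s t
  rw [LinearIsometryEquiv.norm_map, LinearIsometryEquiv.norm_map, two_mul]

variable {e}

lemma inner_interp_cornerDir_frameAt (t : ℝ) {v : H} (hv : ⟪e 1, v⟫ = 0) :
    ⟪interp (cornerDir e) t, frameAt e t v⟫ = 0 := by
  obtain ⟨n, θ, -, hinterp⟩ := exists_interp_eq (V := H) t
  have horth (k : ℤ) : ⟪cornerDir e k, frame e k v⟫ = 0 := by
    rw [inner_cornerDir_frame, hv, mul_zero]
  have hcross : ⟪cornerDir e n, frame e (n + 1) v⟫ = -⟪cornerDir e (n + 1), frame e n v⟫ := by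
    rw [frame_succ_apply, inner_quarterTurn (norm_cornerDir_eq e _ _)]
  rw [frameAt, hinterp, hinterp]
  simp only [inner_add_left, inner_add_right, real_inner_smul_left, inner_smul_right, horth, hcross]
  ring

lemma norm_le_two_mul_norm_frameAt (t : ℝ) (v : H) : ‖v‖ ≤ 2 * ‖frameAt e t v‖ := by
  obtain ⟨n, θ, ⟨hθ₀, hθ₁⟩, hinterp⟩ := exists_interp_eq (V := H) t
  have hnonneg : 0 ≤ ⟪frame e n v, frame e (n + 1) v⟫ := by
    rw [frame_succ_apply]
    exact inner_self_quarterTurn_nonneg (cornerDir_ne_zero e n) (norm_cornerDir_eq e _ _)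
      (inner_cornerDir_succ e n) _
  have hsq : ‖frameAt e t v‖ ^ 2
      = ((1 - θ) ^ 2 + θ ^ 2) * ‖v‖ ^ 2
        + 2 * (θ * (1 - θ)) * ⟪frame e n v, frame e (n + 1) v⟫ := by
    rw [frameAt, hinterp, norm_add_sq_real, norm_smul, norm_smul, LinearIsometryEquiv.norm_map,
      LinearIsometryEquiv.norm_map, mul_pow, mul_pow, Real.norm_eq_abs, Real.norm_eq_abs, sq_abs,
      sq_abs, real_inner_smul_left, inner_smul_right]
    ring
  have hcross : 0 ≤ 2 * (θ * (1 - θ)) * ⟪frame e n v, frame e (n + 1) v⟫ :=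
    mul_nonneg (mul_nonneg zero_le_two (mul_nonneg hθ₀ (sub_nonneg.2 hθ₁))) hnonneg
  have hcoeff : 1 / 4 ≤ (1 - θ) ^ 2 + θ ^ 2 := by nlinarith [sq_nonneg (1 - 2 * θ)]
  refine le_of_sq_le_sq ?_ (by positivity)
  nlinarith [mul_le_mul_of_nonneg_right hcoeff (sq_nonneg ‖v‖)]

lemma exists_frameAt_eq (t : ℝ) {z : H} (hz : ⟪interp (cornerDir e) t, z⟫ = 0) :
    ∃ v, ⟪e 1, v⟫ = 0 ∧ frameAt e t v = z := by
  obtain ⟨n, θ, -, hinterp⟩ := exists_interp_eq (V := H) t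
  rw [hinterp, inner_add_left, real_inner_smul_left, real_inner_smul_left] at hz
  obtain ⟨w, hw, hwz⟩ := exists_interp_quarterTurn_eq (cornerDir_ne_zero e n)
    (norm_cornerDir_eq e _ _) (inner_cornerDir_succ e n) hz
  refine ⟨(frame e n).symm w, ?_, ?_⟩
  · have := inner_cornerDir_frame e n ((frame e n).symm w)
    rw [LinearIsometryEquiv.apply_symm_apply, hw] at this
    exact (mul_eq_zero.1 this.symm).resolve_left (by positivity)
  · rw [frameAt, hinterp, frame_succ_apply, LinearIsometryEquiv.apply_symm_apply, hwz]

end Frame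

section Bend

open scoped RealInnerProductSpace

variable {H : Type*} [NormedAddCommGroup H] [InnerProductSpace ℝ H] (e : HilbertBasis ℤ ℝ H)

/-- The point with normal coordinate `v` over the point of the broken line with parameter `t`. -/
def bend (t : ℝ) (v : H) : H := interp e t + frameAt e t v

lemma bend_sub_bend (s t : ℝ) (v w : H) : bend e t v - bend e s w
    = (interp e t - interp e s) + frameAt e t (v - w) + (frameAt e t w - frameAt e s w) := by
  rw [bend, bend, frameAt_sub]
  abel

variable {e} {s t : ℝ} {v w : H}

lemma norm_bend_sub_bend_le (hw : ‖w‖ ≤ 1 / 100) :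
    ‖bend e t v - bend e s w‖ ≤ 3 * |t - s| + ‖v - w‖ := by
  rw [bend_sub_bend]
  have hmul : 2 * ‖w‖ * |t - s| ≤ 1 * |t - s| := by gcongr; linarith
  linarith [norm_add₃_le (a := interp e t - interp e s) (b := frameAt e t (v - w))
    (c := frameAt e t w - frameAt e s w), norm_interp_basis_sub_le e s t,
    norm_frameAt_le e t (v - w), norm_frameAt_sub_frameAt_le e s t w]

lemma inner_interp_sub_bend_ge (hst : |t - s| ≤ 1 / 4) (hw : ⟪e 1, w⟫ = 0) (hw' : ‖w‖ ≤ 1 / 100) :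
    2 / 5 * (t - s) ^ 2 ≤ (t - s) * ⟪interp (cornerDir e) t, interp e t - bend e s w⟫ := by
  set N := interp (cornerDir e) t
  set Y := frameAt e t w - frameAt e s w
  have hN : ‖N‖ ≤ 2 := norm_interp_le (norm_cornerDir_le e) t
  have hY : ‖Y‖ ≤ |t - s| / 50 := by
    refine (norm_frameAt_sub_frameAt_le e s t w).trans ?_
    nlinarith [abs_nonneg (t - s)]
  have hdecomp : interp e t - bend e s w = (interp e t - interp e s) + Y - frameAt e t w := by
    simp only [bend, Y]
    abel
  have hNY : |(t - s) * ⟪N, Y⟫| ≤ |t - s| * (2 * (|t - s| / 50)) := by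
    rw [abs_mul]
    gcongr
    exact (abs_real_inner_le_norm N Y).trans (by gcongr)
  rw [hdecomp, inner_sub_right, inner_add_right, inner_interp_cornerDir_frameAt t hw]
  nlinarith [half_sq_sub_le_inner_interp (e := e) hst, neg_abs_le ((t - s) * ⟪N, Y⟫),
    sq_abs (t - s)]

lemma abs_sub_le_norm_bend_sub (hst : |t - s| ≤ 1 / 4) (hv : ⟪e 1, v⟫ = 0) (hw : ⟪e 1, w⟫ = 0)
    (hw' : ‖w‖ ≤ 1 / 100) : |t - s| ≤ 5 * ‖bend e t v - bend e s w‖ := by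
  set N := interp (cornerDir e) t
  set X := bend e t v - bend e s w
  have hN : ‖N‖ ≤ 2 := norm_interp_le (norm_cornerDir_le e) t
  have hNX : ⟪N, interp e t - bend e s w⟫ = ⟪N, X⟫ := by
    simp only [X]
    rw [bend.eq_def e t v, add_sub_right_comm, inner_add_right _ _ (frameAt e t v),
      inner_interp_cornerDir_frameAt t hv, add_zero]
  have hle : |t - s| * (2 / 5 * |t - s|) ≤ |t - s| * (2 * ‖X‖) := by
    calc |t - s| * (2 / 5 * |t - s|) = 2 / 5 * (t - s) ^ 2 := by rw [← sq_abs]; ring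
      _ ≤ (t - s) * ⟪N, X⟫ := hNX ▸ inner_interp_sub_bend_ge hst hw hw'
      _ ≤ |t - s| * |⟪N, X⟫| := (le_abs_self _).trans (abs_mul _ _).le
      _ ≤ |t - s| * (2 * ‖X‖) := by
        gcongr
        exact (abs_real_inner_le_norm N X).trans (by gcongr)
  rcases (abs_nonneg (t - s)).eq_or_lt with h0 | hpos
  · rw [← h0]
    positivity
  · linarith [le_of_mul_le_mul_left hle hpos]

lemma norm_sub_le_norm_bend_sub (hst : |t - s| ≤ 1 / 4) (hv : ⟪e 1, v⟫ = 0) (hw : ⟪e 1, w⟫ = 0)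
    (hw' : ‖w‖ ≤ 1 / 100) : ‖v - w‖ ≤ 24 * ‖bend e t v - bend e s w‖ := by
  set X := bend e t v - bend e s w with hX
  have hframe : frameAt e t (v - w)
      = X - (interp e t - interp e s) - (frameAt e t w - frameAt e s w) := by
    rw [hX, bend_sub_bend]
    abel
  have hle : ‖frameAt e t (v - w)‖ ≤ ‖X‖ + 2 * |t - s| + 2 * ‖w‖ * |t - s| := by
    rw [hframe]
    linarith [norm_sub_le (X - (interp e t - interp e s)) (frameAt e t w - frameAt e s w),
      norm_sub_le X (interp e t - interp e s), norm_interp_basis_sub_le e s t,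
      norm_frameAt_sub_frameAt_le e s t w]
  have hmul : 2 * ‖w‖ * |t - s| ≤ 1 / 50 * |t - s| := by gcongr; linarith
  linarith [norm_le_two_mul_norm_frameAt (e := e) t (v - w),
    abs_sub_le_norm_bend_sub hst hv hw hw', norm_nonneg X]

lemma bend_injective (hv : ⟪e 1, v⟫ = 0) (hw : ⟪e 1, w⟫ = 0) (hv' : ‖v‖ ≤ 1 / 100)
    (hw' : ‖w‖ ≤ 1 / 100) (heq : bend e t v = bend e s w) : t = s ∧ v = w := by
  rcases le_total |t - s| (1 / 4) with hst | hst
  · have ht := abs_sub_le_norm_bend_sub hst hv hw hw'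
    have hvw := norm_sub_le_norm_bend_sub hst hv hw hw'
    rw [heq, sub_self, norm_zero, mul_zero] at ht hvw
    exact ⟨sub_eq_zero.1 (abs_nonpos_iff.1 ht), sub_eq_zero.1 (norm_le_zero_iff.1 hvw)⟩
  · have hdiff : interp e t - interp e s = frameAt e s w - frameAt e t v := by
      rw [bend, bend] at heq
      rw [sub_eq_sub_iff_add_eq_add, heq, add_comm]
    have hfar := hdiff ▸ eighth_le_norm_interp_sub (e := e) hst
    linarith [norm_sub_le (frameAt e s w) (frameAt e t v), norm_frameAt_le e s w,
      norm_frameAt_le e t v]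

/- The parameter `t` is a zero of the inner product of `y - interp e t` with the direction
interpolated at `t`, which changes sign on the interval of radius `1 / 4` about `s`. -/
lemma exists_bend_eq (hw : ⟪e 1, w⟫ = 0) (hw' : ‖w‖ ≤ 1 / 100) {y : H}
    (hy : ‖y - bend e s w‖ < 1 / 100) :
    ∃ t v, |t - s| ≤ 1 / 4 ∧ ⟪e 1, v⟫ = 0 ∧ bend e t v = y := by
  set ψ : ℝ → ℝ := fun t => ⟪interp (cornerDir e) t, y - interp e t⟫
  have hψ_cont : Continuous ψ :=
    (continuous_interp fun _ => norm_cornerDir_sub_le e _ _).inner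
      (continuous_const.sub (continuous_interp fun _ => norm_basis_sub_le e _ _))
  have hψ_sign (t : ℝ) (ht : |t - s| = 1 / 4) : (t - s) * ψ t < 0 := by
    have hψ_eq : ψ t = ⟪interp (cornerDir e) t, y - bend e s w⟫
        - ⟪interp (cornerDir e) t, interp e t - bend e s w⟫ := by
      rw [← inner_sub_right, sub_sub_sub_cancel_right]
    have hinner : |⟪interp (cornerDir e) t, y - bend e s w⟫| ≤ 2 * (1 / 100) :=
      (abs_real_inner_le_norm _ _).trans <|
        mul_le_mul (norm_interp_le (norm_cornerDir_le e) t) hy.le (norm_nonneg _) zero_le_two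
    have hmul : (t - s) * ⟪interp (cornerDir e) t, y - bend e s w⟫ ≤ 1 / 4 * (2 * (1 / 100)) := by
      refine (le_abs_self _).trans ?_
      rw [abs_mul, ht]
      gcongr
    have hge := inner_interp_sub_bend_ge ht.le hw hw'
    rw [← sq_abs, ht] at hge
    rw [hψ_eq]
    linarith
  obtain ⟨t, ht, hzero⟩ : ∃ t ∈ Icc (s - 1 / 4) (s + 1 / 4), ψ t = 0 := by
    refine intermediate_value_Icc' (by linarith) hψ_cont.continuousOn ⟨?_, ?_⟩
    · linarith [hψ_sign (s + 1 / 4) (by norm_num)]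
    · linarith [hψ_sign (s - 1 / 4) (by norm_num)]
  obtain ⟨v, hv, hframe⟩ := exists_frameAt_eq t hzero
  exact ⟨t, v, abs_le.2 ⟨by linarith [ht.1], by linarith [ht.2]⟩, hv, by
    rw [bend, hframe, add_sub_cancel]⟩

end Bend

section TubeMap

open scoped RealInnerProductSpace

variable {H : Type*} [NormedAddCommGroup H] [InnerProductSpace ℝ H] (e : HilbertBasis ℤ ℝ H)

/-- The component orthogonal to the axis of the tube. -/
def perp : H →L[ℝ] H := (ℝ ∙ e 1)ᗮ.starProjection

lemma perp_apply (x : H) : perp e x = x - ⟪e 1, x⟫ • e 1 := by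
  rw [perp, Submodule.starProjection_orthogonal_val,
    Submodule.starProjection_unit_singleton ℝ (norm_basis e 1)]

lemma inner_perp (x : H) : ⟪e 1, perp e x⟫ = 0 :=
  Submodule.mem_orthogonal_singleton_iff_inner_right.1
    (Submodule.starProjection_apply_mem (ℝ ∙ e 1)ᗮ x)

lemma norm_perp_le (x : H) : ‖perp e x‖ ≤ ‖x‖ :=
  Submodule.norm_starProjection_apply_le _ x

lemma abs_inner_basis_le (x : H) : |⟪e 1, x⟫| ≤ ‖x‖ := by
  simpa only [norm_basis, one_mul] using abs_real_inner_le_norm (e 1) x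

lemma norm_le_abs_inner_add_norm_perp (x : H) : ‖x‖ ≤ |⟪e 1, x⟫| + ‖perp e x‖ :=
  calc ‖x‖ = ‖⟪e 1, x⟫ • e 1 + perp e x‖ := by rw [perp_apply, add_sub_cancel]
    _ ≤ ‖⟪e 1, x⟫ • e 1‖ + ‖perp e x‖ := norm_add_le _ _
    _ = |⟪e 1, x⟫| + ‖perp e x‖ := by rw [norm_smul, norm_basis, mul_one, Real.norm_eq_abs]

lemma inner_smul_add_of_inner_eq_zero {v : H} (hv : ⟪e 1, v⟫ = 0) (t : ℝ) :
    ⟪e 1, t • e 1 + v⟫ = t := by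
  rw [inner_add_right, real_inner_smul_right, hv, real_inner_self_eq_norm_sq, norm_basis]
  ring

lemma perp_smul_add_of_inner_eq_zero {v : H} (hv : ⟪e 1, v⟫ = 0) (t : ℝ) :
    perp e (t • e 1 + v) = v := by
  rw [perp_apply, inner_smul_add_of_inner_eq_zero e hv, add_sub_cancel_left]

/-- The map that bends a tube about the axis onto a tube about the broken line, after shrinking it
by the factor `c` in the directions orthogonal to the axis. -/
def tubeMap (c : ℝ) (x : H) : H := bend e ⟪e 1, x⟫ (c • perp e x)

lemma inner_smul_perp (c : ℝ) (x : H) : ⟪e 1, c • perp e x⟫ = 0 := by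
  rw [real_inner_smul_right, inner_perp, mul_zero]

variable {e} {c r : ℝ}

lemma norm_smul_perp_le (hc : 0 ≤ c) (hcr : c * r ≤ 1 / 100) {x : H} (hx : x ∈ tube e r) :
    ‖c • perp e x‖ ≤ 1 / 100 := by
  have hperp : ‖perp e x‖ ≤ r := perp_apply e x ▸ ((mem_tube_iff e).1 hx).le
  rw [norm_smul, Real.norm_of_nonneg hc]
  exact (mul_le_mul_of_nonneg_left hperp hc).trans hcr

lemma norm_smul_perp_sub (hc : 0 ≤ c) (x y : H) :
    ‖c • perp e x - c • perp e y‖ = c * ‖perp e (x - y)‖ := by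
  rw [← smul_sub, ← map_sub, norm_smul, Real.norm_of_nonneg hc]

lemma norm_tubeMap_sub_le (hc : 0 ≤ c) (hc1 : c ≤ 1) (hcr : c * r ≤ 1 / 100) {y : H}
    (hy : y ∈ tube e r) (x : H) : ‖tubeMap e c x - tubeMap e c y‖ ≤ 4 * ‖x - y‖ := by
  have hbend := norm_bend_sub_bend_le (e := e) (t := ⟪e 1, x⟫) (s := ⟪e 1, y⟫)
    (v := c • perp e x) (norm_smul_perp_le hc hcr hy)
  have hshrink : c * ‖perp e (x - y)‖ ≤ ‖x - y‖ :=
    (mul_le_of_le_one_left (norm_nonneg _) hc1).trans (norm_perp_le e _)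
  rw [norm_smul_perp_sub hc, ← inner_sub_right] at hbend
  rw [tubeMap, tubeMap]
  linarith [abs_inner_basis_le e (x - y)]

lemma norm_sub_le_norm_tubeMap_sub (hc : 0 < c) (hc1 : c ≤ 1) (hcr : c * r ≤ 1 / 100) {x y : H}
    (hy : y ∈ tube e r) (hxy : |⟪e 1, x - y⟫| ≤ 1 / 4) :
    ‖x - y‖ ≤ 30 / c * ‖tubeMap e c x - tubeMap e c y‖ := by
  set δ := ‖tubeMap e c x - tubeMap e c y‖
  have hinner : ⟪e 1, x - y⟫ = ⟪e 1, x⟫ - ⟪e 1, y⟫ := inner_sub_right _ _ _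
  have haxial : |⟪e 1, x - y⟫| ≤ 5 * δ := hinner ▸ abs_sub_le_norm_bend_sub (hinner ▸ hxy)
    (inner_smul_perp e c x) (inner_smul_perp e c y) (norm_smul_perp_le hc.le hcr hy)
  have hnormal : c * ‖perp e (x - y)‖ ≤ 24 * δ := norm_smul_perp_sub (e := e) hc.le x y ▸
    norm_sub_le_norm_bend_sub (hinner ▸ hxy) (inner_smul_perp e c x) (inner_smul_perp e c y)
      (norm_smul_perp_le hc.le hcr hy)
  rw [div_mul_eq_mul_div, le_div_iff₀' hc]
  calc c * ‖x - y‖ ≤ c * (|⟪e 1, x - y⟫| + ‖perp e (x - y)‖) := by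
        gcongr
        exact norm_le_abs_inner_add_norm_perp e _
    _ ≤ |⟪e 1, x - y⟫| + c * ‖perp e (x - y)‖ := by
        rw [mul_add]
        gcongr
        exact mul_le_of_le_one_left (abs_nonneg _) hc1
    _ ≤ 30 * δ := by linarith [norm_nonneg (tubeMap e c x - tubeMap e c y)]

lemma injOn_tubeMap (hc : 0 < c) (hcr : c * r ≤ 1 / 100) : InjOn (tubeMap e c) (tube e r) := by
  intro x hx y hy heq
  obtain ⟨haxial, hnormal⟩ := bend_injective (inner_smul_perp e c x) (inner_smul_perp e c y)
    (norm_smul_perp_le hc.le hcr hx) (norm_smul_perp_le hc.le hcr hy) heq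
  have hperp := smul_right_injective H hc.ne' hnormal
  rw [perp_apply, perp_apply, haxial] at hperp
  exact sub_left_injective hperp

lemma isOpen_image_tubeMap (hc : 0 < c) (hc1 : c ≤ 1) (hcr : c * r ≤ 1 / 100) {s : Set H}
    (hs : IsOpen s) (hsub : s ⊆ tube e r) : IsOpen (tubeMap e c '' s) := by
  rw [Metric.isOpen_iff]
  rintro _ ⟨x, hx, rfl⟩
  obtain ⟨ε, hε, hball⟩ := Metric.isOpen_iff.1 hs x hx
  refine ⟨min (1 / 100) (ε / (30 / c)), by positivity, fun y hy => ?_⟩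
  rw [mem_ball_iff_norm, lt_min_iff] at hy
  obtain ⟨t, v, ht, hv, rfl⟩ :=
    exists_bend_eq (inner_smul_perp e c x) (norm_smul_perp_le hc.le hcr (hsub hx)) hy.1
  have hcv : ⟪e 1, c⁻¹ • v⟫ = 0 := by rw [real_inner_smul_right, hv, mul_zero]
  set z := t • e 1 + c⁻¹ • v
  have hz : ⟪e 1, z⟫ = t := inner_smul_add_of_inner_eq_zero e hcv t
  have himage : tubeMap e c z = bend e t v := by
    rw [tubeMap, hz, perp_smul_add_of_inner_eq_zero e hcv, smul_inv_smul₀ hc.ne']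
  refine ⟨z, hball (mem_ball_iff_norm.2 ?_), himage⟩
  calc ‖z - x‖ ≤ 30 / c * ‖tubeMap e c z - tubeMap e c x‖ :=
        norm_sub_le_norm_tubeMap_sub hc hc1 hcr (hsub hx) (by rwa [inner_sub_right, hz])
    _ < ε := by
        rw [himage]
        exact (lt_div_iff₀' (by positivity)).1 hy.2

lemma tubeMap_smul_basis (c t : ℝ) : tubeMap e c (t • e 1) = interp e t := by
  have hinner := inner_smul_add_of_inner_eq_zero e (inner_zero_right _) t
  have hperp := perp_smul_add_of_inner_eq_zero e (inner_zero_right _) t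
  rw [add_zero] at hinner hperp
  have hframe : frameAt e t (0 : H) = 0 :=
    norm_le_zero_iff.1 ((norm_frameAt_le e t 0).trans_eq norm_zero)
  rw [tubeMap, hinner, hperp, smul_zero, bend, hframe, add_zero]

lemma image_axis_tubeMap (c : ℝ) : tubeMap e c '' axis e = brokenLine e := by
  rw [axis, ← range_comp]
  exact (congrArg range (funext (tubeMap_smul_basis c))).trans (range_interp e)

lemma norm_tubeMap_lt (hc : 0 ≤ c) (hcr : c * r ≤ 1 / 100) {x : H} (hx : x ∈ tube e r) :
    ‖tubeMap e c x‖ < 2 := by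
  rw [tubeMap, bend]
  linarith [norm_add_le (interp e ⟪e 1, x⟫) (frameAt e ⟪e 1, x⟫ (c • perp e x)),
    norm_interp_le (fun n => (norm_basis e n).le) ⟪e 1, x⟫,
    norm_frameAt_le e ⟪e 1, x⟫ (c • perp e x), norm_smul_perp_le hc hcr hx]

lemma exists_openPartialHomeomorph_tubeMap (hc : 0 < c) (hc1 : c ≤ 1) (hr : 0 < r)
    (hcr : c * r ≤ 1 / 100) :
    ∃ f : OpenPartialHomeomorph H H, f.source = tube e r ∧ ⇑f = tubeMap e c := by
  have hopen : IsOpen (tube e r) := (isDom_tube e hr).1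
  have hcont : ContinuousOn (tubeMap e c) (tube e r) :=
    (LipschitzOnWith.of_dist_le_mul (K := 4) fun x _ y hy => by
      rw [dist_eq_norm, dist_eq_norm]
      exact norm_tubeMap_sub_le hc.le hc1 hcr hy x).continuousOn
  have hopenMap : IsOpenMap ((tube e r).domRestrict (tubeMap e c)) := fun s hs => by
    rw [domRestrict_eq, image_comp]
    exact isOpen_image_tubeMap hc hc1 hcr (hopen.isOpenMap_subtype_val s hs)
      (Subtype.coe_image_subset _ _)
  exact ⟨OpenPartialHomeomorph.ofContinuousOpenRestrict
    ((injOn_tubeMap hc hcr).toPartialEquiv _ _) hcont hopenMap hopen, rfl, rfl⟩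

lemma isLocBilip_of_eq_tubeMap (hc : 0 < c) (hc1 : c ≤ 1) (hcr : c * r ≤ 1 / 100)
    {f : OpenPartialHomeomorph H H} (hsource : f.source = tube e r) (hcoe : ⇑f = tubeMap e c) :
    IsLocBilip (30 / c) f := by
  intro x hx
  refine ⟨f.source ∩ ball x (1 / 8), inter_mem (f.open_source.mem_nhds hx)
    (ball_mem_nhds x (by norm_num)), inter_subset_left, fun y hy z hz => ?_⟩
  have hyz : |⟪e 1, y - z⟫| ≤ 1 / 4 := by
    linarith [abs_inner_basis_le e (y - z), dist_triangle_right y z x, mem_ball.1 hy.2,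
      mem_ball.1 hz.2, dist_eq_norm y z]
  have hzr : z ∈ tube e r := hsource ▸ hz.1
  have h30 : 30 ≤ 30 / c := (le_div_iff₀ hc).2 (by linarith)
  rw [hcoe]
  constructor
  · exact (div_le_iff₀' (by linarith)).2 (norm_sub_le_norm_tubeMap_sub hc hc1 hcr hzr hyz)
  · exact (norm_tubeMap_sub_le hc.le hc1 hcr hzr y).trans (by gcongr; linarith)

variable (e) in
theorem exists_isLocBilip_tube (hr : 0 < r) :
    ∃ (M : ℝ) (f : OpenPartialHomeomorph H H), 1 ≤ M ∧ IsLocBilip M f ∧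
      f.source = tube e r ∧ f '' axis e = brokenLine e ∧ f.target ⊆ ball 0 2 := by
  obtain ⟨c, hc, hc1, hcr⟩ : ∃ c : ℝ, 0 < c ∧ c ≤ 1 ∧ c * r ≤ 1 / 100 :=
    ⟨min 1 (1 / (100 * r)), by positivity, min_le_left _ _,
      (mul_le_mul_of_nonneg_right (min_le_right _ _) hr.le).trans_eq (by field_simp)⟩
  obtain ⟨f, hsource, hcoe⟩ := exists_openPartialHomeomorph_tubeMap (e := e) hc hc1 hr hcr
  refine ⟨30 / c, f, (one_le_div₀ hc).2 (by linarith),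
    isLocBilip_of_eq_tubeMap hc hc1 hcr hsource hcoe, hsource, ?_, ?_⟩
  · rw [hcoe, image_axis_tubeMap]
  · rw [← f.image_source_eq_target, hsource, hcoe]
    rintro _ ⟨x, hx, rfl⟩
    exact mem_ball_zero_iff.2 (norm_tubeMap_lt hc.le hcr hx)

end TubeMap

section Completeness

variable {ι 𝕜 H : Type*} [RCLike 𝕜] [NormedAddCommGroup H] [InnerProductSpace 𝕜 H]

lemma completeSpace_of_hilbertBasis (e : HilbertBasis ι 𝕜 H) : CompleteSpace H :=
  e.repr.toIsometryEquiv.completeSpace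

end Completeness

end FreeQC

end

theorem theorem1p3_general :
    (¬ ∀ (E E' : Type) [NormedAddCommGroup E] [NormedSpace ℝ E] [CompleteSpace E]
        [NormedAddCommGroup E'] [NormedSpace ℝ E'] [CompleteSpace E']
        (f : OpenPartialHomeomorph E E'),
        2 ≤ Module.rank ℝ E → 2 ≤ Module.rank ℝ E' →
        FreeQC.IsDom f.source → f.source ≠ Set.univ →
        FreeQC.IsDom f.target → f.target ≠ Set.univ →
        (∃ φ₁ : ℝ≥0 ≃ₜ ℝ≥0, FreeQC.IsGrowth φ₁ ∧ FreeQC.IsFQC φ₁ f) →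
        ∃ φ : ℝ≥0 ≃ₜ ℝ≥0, FreeQC.IsGrowth φ ∧
          ∀ D₁ : Set E, FreeQC.IsDom D₁ → D₁ ⊆ f.source → FreeQC.JIneqOn φ f D₁) ∧
    (¬ ∀ (E E' : Type) [NormedAddCommGroup E] [NormedSpace ℝ E] [CompleteSpace E]
        [NormedAddCommGroup E'] [NormedSpace ℝ E'] [CompleteSpace E']
        (f : OpenPartialHomeomorph E E'),
        2 ≤ Module.rank ℝ E → 2 ≤ Module.rank ℝ E' →
        FreeQC.IsDom f.source → f.source ≠ Set.univ →
        FreeQC.IsDom f.target → f.target ≠ Set.univ →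
        (∃ M₁ : ℝ, 1 < M₁ ∧ FreeQC.IsQH M₁ f) →
        ∃ (M : ℝ) (φ : ℝ≥0 ≃ₜ ℝ≥0), 1 ≤ M ∧ (∀ t : ℝ≥0, (φ t : ℝ) = M * t) ∧
          FreeQC.JIneqOn φ f f.source) ∧
    (∃ f : OpenPartialHomeomorph ℂ ℂ, FreeQC.IsSlitMap f) ∧
    (∃ M : ℝ, 1 < M ∧ ∀ f : OpenPartialHomeomorph ℂ ℂ, FreeQC.IsSlitMap f →
      FreeQC.IsQH M f ∧
      (∃ φ₁ : ℝ≥0 ≃ₜ ℝ≥0, FreeQC.IsGrowth φ₁ ∧ (∀ t : ℝ≥0, (φ₁ t : ℝ) = M * t) ∧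
        FreeQC.IsFQC φ₁ f) ∧
      ∀ φ : ℝ≥0 ≃ₜ ℝ≥0,
        ¬ FreeQC.JIneqOn φ f (Metric.ball 0 1) ∧
        ¬ FreeQC.JIneqOn φ f (Metric.ball 0 1 \ {f.symm (-1 / 2)})) ∧
    (∀ (H : Type*) [NormedAddCommGroup H] [InnerProductSpace ℝ H]
      (e : HilbertBasis ℤ ℝ H) (r : ℝ), 0 < r →
      (∃ (M : ℝ) (f : OpenPartialHomeomorph H H), 1 ≤ M ∧ FreeQC.IsLocBilip M f ∧
        f.source = FreeQC.tube e r ∧ f '' FreeQC.axis e = FreeQC.brokenLine e ∧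
        f.target ⊆ Metric.ball 0 2) ∧
      ∀ (M : ℝ) (f : OpenPartialHomeomorph H H), 1 ≤ M → FreeQC.IsLocBilip M f →
        f.source = FreeQC.tube e r → Bornology.IsBounded f.target →
        FreeQC.IsQH (M ^ 2) f ∧
        (∃ φ₁ : ℝ≥0 ≃ₜ ℝ≥0, FreeQC.IsGrowth φ₁ ∧
          (∀ t : ℝ≥0, (φ₁ t : ℝ) = M ^ 2 * t) ∧ FreeQC.IsFQC φ₁ f) ∧
        ∀ φ : ℝ≥0 ≃ₜ ℝ≥0, ¬ FreeQC.JIneqOn φ f (FreeQC.tube e r)) := by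
  obtain ⟨f₀, hf₀⟩ := FreeQC.exists_isSlitMap
  have hFQC {f : OpenPartialHomeomorph ℂ ℂ} (hf : FreeQC.IsSlitMap f) :=
    hf.isFullyQH.exists_isGrowth_isFQC (by norm_num)
  refine ⟨fun h => ?_, fun h => ?_, ⟨f₀, hf₀⟩, ⟨24, by norm_num, fun f hf => ⟨hf.isQH, hFQC hf,
    fun φ => ⟨hf.not_jIneqOn_ball φ, hf.not_jIneqOn_punctured φ⟩⟩⟩, fun H _ _ e r hr =>
      ⟨FreeQC.exists_isLocBilip_tube e hr, fun M f hM hf hsource hbdd => ?_⟩⟩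
  · obtain ⟨φ₁, hφ₁, -, hφ₁f⟩ := hFQC hf₀
    obtain ⟨φ, -, hφ⟩ := h ℂ ℂ f₀ Complex.rank_real_complex.ge Complex.rank_real_complex.ge
      (hf₀.1 ▸ FreeQC.isDom_ball) (hf₀.1 ▸ FreeQC.ball_zero_one_ne_univ)
      (hf₀.2.1 ▸ hf₀.isDom_slitDisk) (hf₀.2.1 ▸ FreeQC.slitDisk_ne_univ) ⟨φ₁, hφ₁, hφ₁f⟩
    exact hf₀.not_jIneqOn_ball φ (hφ _ FreeQC.isDom_ball hf₀.1.ge)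
  · obtain ⟨-, φ, -, -, hφ⟩ := h ℂ ℂ f₀ Complex.rank_real_complex.ge Complex.rank_real_complex.ge
      (hf₀.1 ▸ FreeQC.isDom_ball) (hf₀.1 ▸ FreeQC.ball_zero_one_ne_univ)
      (hf₀.2.1 ▸ hf₀.isDom_slitDisk) (hf₀.2.1 ▸ FreeQC.slitDisk_ne_univ) ⟨24, by norm_num, hf₀.isQH⟩
    exact hf₀.not_jIneqOn_ball φ (hf₀.1 ▸ hφ)
  · have := FreeQC.completeSpace_of_hilbertBasis e
    have hM₀ : 0 < M := one_pos.trans_le hM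
    have hfull := hf.isFullyQH hM₀ (hsource ▸ FreeQC.tube_ne_univ e hr)
      (FreeQC.ne_univ_of_isBounded e hbdd)
    exact ⟨hfull.isQH (pow_pos hM₀ 2) (hsource ▸ FreeQC.isDom_tube e hr)
      (hsource ▸ FreeQC.tube_ne_univ e hr), hfull.exists_isGrowth_isFQC (one_le_pow₀ hM),
      hf.not_jIneqOn_tube e hM₀ hr hsource hbdd⟩

theorem theorem1p3 :
    -- an FQC homeomorphism need not satisfy the distance ratio inequality on all subdomains
    (¬ ∀ (E E' : Type) [NormedAddCommGroup E] [NormedSpace ℝ E] [CompleteSpace E]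
        [NormedAddCommGroup E'] [NormedSpace ℝ E'] [CompleteSpace E']
        (f : OpenPartialHomeomorph E E'),
        2 ≤ Module.rank ℝ E → 2 ≤ Module.rank ℝ E' →
        FreeQC.IsDom f.source → f.source ≠ Set.univ →
        FreeQC.IsDom f.target → f.target ≠ Set.univ →
        (∃ φ₁ : ℝ≥0 ≃ₜ ℝ≥0, FreeQC.IsGrowth φ₁ ∧ FreeQC.IsFQC φ₁ f) →
        ∃ φ : ℝ≥0 ≃ₜ ℝ≥0, FreeQC.IsGrowth φ ∧
          ∀ D₁ : Set E, FreeQC.IsDom D₁ → D₁ ⊆ f.source → FreeQC.JIneqOn φ f D₁) ∧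
    -- a quasihyperbolic homeomorphism need not satisfy it on `D` with a linear function
    (¬ ∀ (E E' : Type) [NormedAddCommGroup E] [NormedSpace ℝ E] [CompleteSpace E]
        [NormedAddCommGroup E'] [NormedSpace ℝ E'] [CompleteSpace E']
        (f : OpenPartialHomeomorph E E'),
        2 ≤ Module.rank ℝ E → 2 ≤ Module.rank ℝ E' →
        FreeQC.IsDom f.source → f.source ≠ Set.univ →
        FreeQC.IsDom f.target → f.target ≠ Set.univ →
        (∃ M₁ : ℝ, 1 < M₁ ∧ FreeQC.IsQH M₁ f) →
        ∃ (M : ℝ) (φ : ℝ≥0 ≃ₜ ℝ≥0), 1 ≤ M ∧ (∀ t : ℝ≥0, (φ t : ℝ) = M * t) ∧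
          FreeQC.JIneqOn φ f f.source) ∧
    -- the conformal maps of the unit disk onto the slit disk
    (∃ f : OpenPartialHomeomorph ℂ ℂ, FreeQC.IsSlitMap f) ∧
    (∃ M : ℝ, 1 < M ∧ ∀ f : OpenPartialHomeomorph ℂ ℂ, FreeQC.IsSlitMap f →
      FreeQC.IsQH M f ∧
      (∃ φ₁ : ℝ≥0 ≃ₜ ℝ≥0, FreeQC.IsGrowth φ₁ ∧ (∀ t : ℝ≥0, (φ₁ t : ℝ) = M * t) ∧
        FreeQC.IsFQC φ₁ f) ∧
      ∀ φ : ℝ≥0 ≃ₜ ℝ≥0,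
        ¬ FreeQC.JIneqOn φ f (Metric.ball 0 1) ∧
        ¬ FreeQC.JIneqOn φ f (Metric.ball 0 1 \ {f.symm (-1 / 2)})) ∧
    -- the maps of a tube about a line onto a neighborhood of the broken line in Hilbert space
    (∀ (H : Type*) [NormedAddCommGroup H] [InnerProductSpace ℝ H] [CompleteSpace H]
      (e : HilbertBasis ℤ ℝ H) (r : ℝ), 0 < r → r ≤ 1 / 10 →
      (∃ (M : ℝ) (f : OpenPartialHomeomorph H H), 1 ≤ M ∧ FreeQC.IsLocBilip M f ∧
        f.source = FreeQC.tube e r ∧ f '' FreeQC.axis e = FreeQC.brokenLine e ∧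
        f.target ⊆ Metric.ball 0 2) ∧
      ∀ (M : ℝ) (f : OpenPartialHomeomorph H H), 1 ≤ M → FreeQC.IsLocBilip M f →
        f.source = FreeQC.tube e r → FreeQC.brokenLine e ⊆ f.target →
        Bornology.IsBounded f.target →
        FreeQC.IsQH (M ^ 2) f ∧
        (∃ φ₁ : ℝ≥0 ≃ₜ ℝ≥0, FreeQC.IsGrowth φ₁ ∧
          (∀ t : ℝ≥0, (φ₁ t : ℝ) = M ^ 2 * t) ∧ FreeQC.IsFQC φ₁ f) ∧
        ∀ φ : ℝ≥0 ≃ₜ ℝ≥0, ¬ FreeQC.JIneqOn φ f (FreeQC.tube e r)) := by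
  obtain ⟨ha, hb, hc, hc', hd⟩ := theorem1p3_general
  exact ⟨ha, hb, hc, hc', fun H _ _ _ e r hr _ =>
    ⟨(hd H e r hr).1, fun M f hM hf hsource _ => (hd H e r hr).2 M f hM hf hsource⟩⟩
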